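/- Let $n\ge 3$ and let $\mathbf P_n$ be a convex $n$-gon with vertices labeled $1,\dots,n$ clockwise. A *bicolored subdivision* $\sigma$ of type $(k,n)$ is a partition of $\mathbf P_n$ into black and white polygons (with vertices among those of $\mathbf P_n$) such that two polygons sharing an edge have different colors and such that any triangulation of the black polygons has exactly $k$ black triangles. For $i\ne j$ the arc $i\to j$ is *compatible* with $\sigma$ if it bounds or lies inside a polygon of $\sigma$, and $\mathrm{area}(i\to j)$ is the number of black triangles to the left of $i\to j$, that is, on the side of the vertices $i+1,\dots,j-1$ (cyclically), in a triangulation of the black polygons that the arc does not cross. Write $x_S=\sum_{s\in S}x_s$ and let $[i,j]$ denote cyclic intervals in $[n]$. The tile $\Gamma_\sigma$ of the hypersimplex $\Delta_{k+1,n}$ is the subset of $\mathbb R^n$ cut out by $$x_{[n]}=k+1,\qquad \mathrm{area}(i\to j)\le x_{[i,j-1]}\le \mathrm{area}(i\to j)+1\quad\text{for all compatible arcs } i\to j.$$ For $w=w_1\cdots w_n\in S_n$, a letter $i$ is a *cyclic left descent* of $w$ if $i<n$ and $i$ is to the right of $i+1$ in $w$, or if $i=n$ and $1$ is to the left of $n$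 in $w$. Let $D_n=\{w\in S_n: w_n=n\}$, and let $D_{k+1,n}$ be the set of $w\in D_n$ with exactly $k+1$ cyclic left descents. For $r\in[n]$ let $I_r$ be the set of cyclic left descents of the cyclic rotation of $w$ ending at $r$; the *$w$-simplex* $\Delta_{(w)}$ is the convex hull of the points $e_{I_1},\dots,e_{I_n}$, where $e_I=\sum_{i\in I}e_i$. Let $(w)$ be the cycle $(w_1\ w_2\cdots w_n)$. A *cyclic order* on a set $X$ is a ternary relation $C\subset X^3$ such that for all $a,b,c,d\in X$: $(a,b,c)\in C$ implies $(c,a,b)\in C$ and $(c,b,a)\notin C$, and $(a,b,c),(a,c,d)\in C$ imply $(a,b,d)\in C$. It is *total* if for all pairwise distinct $a,b,c$ one of $(a,b,c),(a,c,b)$ lies in $C$. The set $\mathrm{Ext}(C)$ of *circular extensions* of $C$ consists of the total cyclic orders containing $C$. The chain of a list $x_1,\dots,x_m$ of distinct elements consists of the triples $(x_i,x_j,x_l)$, $i<j<l$, and their cyclic rotations; $C_w$ is the chain of $w_1,\dots,w_n$; and $C_\sigma$ is the union of the chains of the vertex lists of the polygons of $\sigma$, read clockwise for white and counterclockwise for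 black polygons. **Theorem.** Let $\sigma$ be a bicolored subdivision of type $(k,n)$. Then $$\Gamma_\sigma=\bigcup_w\Delta_{(w)},$$ where the union is over all $w\in D_{k+1,n}$ such that - the vertices of each white polygon of $\sigma$, listed clockwise, appear in this order in the cycle $(w)$; - the vertices of each black polygon of $\sigma$, listed counterclockwise, appear in this order in the cycle $(w)$. Moreover, for $w\in D_{k+1,n}$, $\Delta_{(w)}\subseteq\Gamma_\sigma$ if and only if $w$ satisfies these two conditions. Equivalently, $C_\sigma$ is a cyclic order, $$\Gamma_\sigma=\bigcup_{w\in D_n,\ C_w\in\mathrm{Ext}(C_\sigma)}\Delta_{(w)},$$ and the $w$-simplices in $\Gamma_\sigma$ are indexed by the circular extensions of $C_\sigma$: the map $w\mapsto C_w$ is a bijection from $\{w\in D_{k+1,n}:\Delta_{(w)}\subseteq\Gamma_\sigma\}$ onto $\mathrm{Ext}(C_\sigma)$, and $w\mapsto\Delta_{(w)}$ is injective on this set. -/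

import Mathlib

namespace Hypersimplex

/-! The labels `1, …, n` are the elements `0, …, n - 1` of `Fin n`; arithmetic in `Fin n` is
modulo `n`, so that `x - a` is the number of clockwise steps from `a` to `x`. -/

/-- The cyclic interval `[a, b] = {a, a + 1, …, b}`. -/
def cycIcc {n : ℕ} (a b : Fin n) : Finset (Fin n) :=
  Finset.univ.filter fun x => x - a ≤ b - a

/-- The cyclic interval `[a, b - 1] = {a, a + 1, …, b - 1}`, for `a ≠ b`. -/
def cycIco {n : ℕ} (a b : Fin n) : Finset (Fin n) :=
  Finset.univ.filter fun x => x - a < b - a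

/-! ### Bicolored subdivisions -/

/-- A bicolored subdivision of a convex `n`-gon whose vertices are labeled clockwise by `Fin n`.
A polygon is given by its set of vertices. -/
structure BicoloredSubdivision (n : ℕ) where
  /-- the white polygons -/
  white : Finset (Finset (Fin n))
  /-- the black polygons -/
  black : Finset (Finset (Fin n))
  /-- no polygon has two colors -/
  color_disjoint : Disjoint white black
  /-- polygons have at least three vertices -/
  three_le_card : ∀ P ∈ white ∪ black, 3 ≤ P.card
  /-- distinct polygons have disjoint interiors: they lie on different sides of some chord -/
  separated : ∀ P ∈ white ∪ black, ∀ Q ∈ white ∪ black, P ≠ Q →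
    ∃ i j : Fin n, P ⊆ cycIcc i j ∧ Q ⊆ cycIcc j i
  /-- the polygons cover the `n`-gon, first part: each edge of the `n`-gon lies in a polygon -/
  cover_boundary : ∀ a b : Fin n, (b - a).val = 1 → ∃ P ∈ white ∪ black, a ∈ P ∧ b ∈ P
  /-- the polygons cover the `n`-gon, second part: if the chord from `a` to `b` lies in a polygon
  and the `n`-gon has a vertex strictly to the left of it, then so has some polygon containing the
  chord; hence there are polygons on both sides of each side that is a diagonal -/
  cover_left : ∀ P ∈ white ∪ black, ∀ a ∈ P, ∀ b ∈ P, 1 < (b - a).val →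
    ∃ Q ∈ white ∪ black, a ∈ Q ∧ b ∈ Q ∧ ∃ c ∈ Q, 0 < (c - a).val ∧ (c - a).val < (b - a).val
  /-- two white polygons do not share an edge -/
  white_no_common_edge : ∀ P ∈ white, ∀ Q ∈ white, P ≠ Q → ∀ a ∈ P ∩ Q, ∀ b ∈ P ∩ Q, a = b
  /-- two black polygons do not share an edge -/
  black_no_common_edge : ∀ P ∈ black, ∀ Q ∈ black, P ≠ Q → ∀ a ∈ P ∩ Q, ∀ b ∈ P ∩ Q, a = b

namespace BicoloredSubdivision

variable {n : ℕ} (σ : BicoloredSubdivision n)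

/-- The number of black triangles in any triangulation of the black polygons
(a polygon with `r` vertices is triangulated by `r - 2` triangles). -/
def numBlackTriangles : ℕ := ∑ P ∈ σ.black, (P.card - 2)

/-- `σ` has type `(k, n)`. -/
def HasType (k : ℕ) : Prop := σ.numBlackTriangles = k

/-- The arc `a → b` bounds a polygon of `σ` or lies inside one. -/
def Compatible (a b : Fin n) : Prop := a ≠ b ∧ ∃ P ∈ σ.white ∪ σ.black, a ∈ P ∧ b ∈ P

/-- The number of black triangles to the left of a compatible arc `a → b`. The part of a black
polygon `P` to the left of the arc has the vertex set `P ∩ [a, b]`; it consists of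
`|P ∩ [a, b]| - 2` triangles, and of none (truncated subtraction) if `|P ∩ [a, b]| ≤ 2`. -/
def area (a b : Fin n) : ℕ := ∑ P ∈ σ.black, ((P ∩ cycIcc a b).card - 2)

/-- The tile `Γ_σ` of the hypersimplex `Δ_{k+1,n}`, for `σ` of type `(k, n)`, as a subset of `ℝⁿ`:
it is cut out by `x_{[n]} = k + 1` and `area(a → b) ≤ x_{[a, b-1]} ≤ area(a → b) + 1` for all
compatible arcs `a → b`. -/
def tile : Set (Fin n → ℝ) :=
  {x | ∑ i, x i = (σ.numBlackTriangles : ℝ) + 1 ∧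
    ∀ a b, σ.Compatible a b →
      (σ.area a b : ℝ) ≤ ∑ i ∈ cycIco a b, x i ∧
      ∑ i ∈ cycIco a b, x i ≤ (σ.area a b : ℝ) + 1}

end BicoloredSubdivision

/-! ### Permutations and `w`-simplices

A permutation `w` is identified with the word `w 0, w 1, …, w (n - 1)`. -/

/-- The cyclic left descents of `w`: the letters `i < n` to the right of `i + 1` in `w`, and the
letter `n` if `1` is to the left of `n` in `w`. -/
def cDes {n : ℕ} (w : Equiv.Perm (Fin n)) : Finset (Fin n) :=
  Finset.univ.filter fun i =>
    (∃ j : Fin n, j.val = i.val + 1 ∧ w.symm j < w.symm i) ∨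
    (i.val + 1 = n ∧ ∃ j : Fin n, j.val = 0 ∧ w.symm j < w.symm i)

/-- `w^{(a)}`, the cyclic rotation of the word `w` whose last letter is `a`. -/
def rotateTo {n : ℕ} [NeZero n] (w : Equiv.Perm (Fin n)) (a : Fin n) : Equiv.Perm (Fin n) :=
  (Equiv.addRight (w.symm a + 1)).trans w

/-- `D_n`: the permutations whose last letter is the largest one. -/
def DAll (n : ℕ) : Set (Equiv.Perm (Fin n)) := {w | ∀ i : Fin n, i.val + 1 = n → w i = i}

/-- `D_{m,n}`: the elements of `D_n` with `m` cyclic left descents. -/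
def D (m n : ℕ) : Set (Equiv.Perm (Fin n)) := {w | w ∈ DAll n ∧ (cDes w).card = m}

/-- `e_I`, the sum of the standard basis vectors `e_i` with `i ∈ I`. -/
def e {n : ℕ} (I : Finset (Fin n)) : Fin n → ℝ := fun i => if i ∈ I then 1 else 0

/-- The `w`-simplex `Δ_(w)`: the convex hull of the points `e_{I_r}`, `I_r = cDes (w^{(r)})`. -/
def wSimplex {n : ℕ} [NeZero n] (w : Equiv.Perm (Fin n)) : Set (Fin n → ℝ) :=
  convexHull ℝ (Set.range fun r : Fin n => e (cDes (rotateTo w r)))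

/-! ### Cyclic orders -/

/-- A (partial) cyclic order. -/
structure IsCyclicOrder {X : Type*} (C : Set (X × X × X)) : Prop where
  cyclicity : ∀ a b c, (a, b, c) ∈ C → (c, a, b) ∈ C
  asymmetry : ∀ a b c, (a, b, c) ∈ C → (c, b, a) ∉ C
  transitivity : ∀ a b c d, (a, b, c) ∈ C → (a, c, d) ∈ C → (a, b, d) ∈ C

/-- A total cyclic order. -/
structure IsTotalCyclicOrder {X : Type*} (C : Set (X × X × X)) : Prop extends
    IsCyclicOrder C where
  total : ∀ a b c, a ≠ b → b ≠ c → a ≠ c → (a, b, c) ∈ C ∨ (a, c, b) ∈ C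

/-- `Ext(C)`, the circular extensions of `C`. -/
def Ext {X : Type*} (C : Set (X × X × X)) : Set (Set (X × X × X)) :=
  {C' | IsTotalCyclicOrder C' ∧ C ⊆ C'}

/-- The chain `C_{(x_1, …, x_m)}` of a list of distinct elements: the triples
`(x_i, x_j, x_l)` with `i < j < l`, and their cyclic rotations. -/
def chain {X : Type*} (l : List X) : Set (X × X × X) :=
  {t | [t.1, t.2.1, t.2.2].Sublist l ∨ [t.2.1, t.2.2, t.1].Sublist l ∨
    [t.2.2, t.1, t.2.1].Sublist l}

/-- `C_w`: the letters of `w` are placed clockwise on a circle. -/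
def wOrder {n : ℕ} (w : Equiv.Perm (Fin n)) : Set (Fin n × Fin n × Fin n) :=
  chain (List.ofFn w)

/-- The vertices of a polygon in clockwise order. -/
def clockwise {n : ℕ} (P : Finset (Fin n)) : List (Fin n) := P.sort (· ≤ ·)

/-- The vertices of a polygon in counterclockwise order. -/
def counterclockwise {n : ℕ} (P : Finset (Fin n)) : List (Fin n) := (clockwise P).reverse

/-- We see `v_1, …, v_r` in order in the cycle `(w)`, that is, in some rotation of the word `w`. -/
def SeenInOrder {n : ℕ} [NeZero n] (w : Equiv.Perm (Fin n)) (v : List (Fin n)) : Prop :=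
  ∃ a : Fin n, v.Sublist (List.ofFn (rotateTo w a))

/-- The `σ`-order `C_σ`, the union of the chains of all polygons. -/
def BicoloredSubdivision.order {n : ℕ} (σ : BicoloredSubdivision n) :
    Set (Fin n × Fin n × Fin n) :=
  (⋃ P ∈ σ.white, chain (clockwise P)) ∪ ⋃ P ∈ σ.black, chain (counterclockwise P)

/-- The vertices of each white polygon appear in clockwise order in `(w)`, and those of each black
polygon in counterclockwise order. -/
def BicoloredSubdivision.Respects {n : ℕ} [NeZero n] (σ : BicoloredSubdivision n)
    (w : Equiv.Perm (Fin n)) : Prop :=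
  (∀ P ∈ σ.white, SeenInOrder w (clockwise P)) ∧
    ∀ P ∈ σ.black, SeenInOrder w (counterclockwise P)

end Hypersimplex

/-! For a word `w`, walk through the letters `a, a + 1, …, b`, always moving forward around the
cycle `(w)`; `wind w a b` counts the full turns. At a vertex of `Δ_(w)` the sum `x_{[a, b-1]}`
counts how often this walk crosses one cut of the circle, so it is `wind` or `wind + 1`, and both
values occur. Hence `Δ_(w)` satisfies the tile inequalities of an arc `a → b` exactly when `wind w a
b` equals the area of the arc. Both numbers vanish on the sides of the `n`-gon. Across a triangle
`a, c, b` of a polygon `P`, the winding gains 1 iff `w` reverses the triple (`wind_add`), and the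
area gains 1 iff `P` is black (`area_add`). Such triangles build every compatible arc from sides, so
equality on all compatible arcs means that `w` respects `σ` (`wSimplex_subset_tile_iff`).

For the covering, let `x` satisfy all tile inequalities strictly. Its coordinates lie in `(0, 1)`,
and sorting the fractional parts of its partial sums gives a `w` with `x ∈ Δ_(w)`
(`exists_mem_wSimplex`). Unit intervals starting at the winding and at the area then overlap, one of
them in an interior point, so these integers agree and `w` respects `σ`. Strict points exist
(`strictTile_nonempty`), hence are dense in the tile, and a finite union of simplices is closed.

A strict point also supplies a word respecting `σ`, whence `C_σ` is asymmetric. Cutting a total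
cyclic order at the largest label identifies circular extensions with words in `D_n`; a simplex
determines all windings, and these determine `C_w`. -/

namespace Hypersimplex

/-- The labels `a`, `b`, `c` are met in this order on a clockwise walk around the polygon. -/
def CycLt {n : ℕ} (a b c : Fin n) : Prop :=
  (a.val < b.val ∧ b.val < c.val) ∨ (b.val < c.val ∧ c.val < a.val) ∨
    (c.val < a.val ∧ a.val < b.val)

instance {n : ℕ} (a b c : Fin n) : Decidable (CycLt a b c) := by
  unfold CycLt; infer_instance

/-! ### Arcs, cyclic intervals and telescoping sums. -/

section Cyclic

variable {n : ℕ}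

theorem CycLt.rotate {a b c : Fin n} (h : CycLt a b c) : CycLt c a b := by
  unfold CycLt at *; omega

theorem CycLt.ne {a b c : Fin n} (h : CycLt a b c) : a ≠ b ∧ b ≠ c ∧ a ≠ c := by
  refine ⟨?_, ?_, ?_⟩ <;> rintro rfl <;> unfold CycLt at h <;> omega

theorem val_sub_eq (x a : Fin n) :
    (x - a).val = if a.val ≤ x.val then x.val - a.val else n + x.val - a.val := by
  rw [Fin.sub_def]
  have hx := x.isLt
  have ha := a.isLt
  split_ifs with h
  · have : n - a.val + x.val = (x.val - a.val) + n := by omega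
    simp only [this, Nat.add_mod_right]
    exact Nat.mod_eq_of_lt (by omega)
  · simp only
    rw [Nat.mod_eq_of_lt (by omega)]
    omega

theorem mem_cycIcc {a b x : Fin n} : x ∈ cycIcc a b ↔
    (a.val ≤ b.val ∧ a.val ≤ x.val ∧ x.val ≤ b.val) ∨
      (b.val < a.val ∧ (a.val ≤ x.val ∨ x.val ≤ b.val)) := by
  have hx := x.isLt
  have ha := a.isLt
  have hb := b.isLt
  simp only [cycIcc, Finset.mem_filter, Finset.mem_univ, true_and, Fin.le_def, val_sub_eq]
  split_ifs <;> omega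

theorem mem_cycIco {a b x : Fin n} : x ∈ cycIco a b ↔
    (a.val ≤ b.val ∧ a.val ≤ x.val ∧ x.val < b.val) ∨
      (b.val < a.val ∧ (a.val ≤ x.val ∨ x.val < b.val)) := by
  have hx := x.isLt
  have ha := a.isLt
  have hb := b.isLt
  simp only [cycIco, Finset.mem_filter, Finset.mem_univ, true_and, Fin.lt_def, val_sub_eq]
  split_ifs <;> omega

theorem cycLt_iff_sub {a b c : Fin n} :
    CycLt a c b ↔ 0 < (c - a).val ∧ (c - a).val < (b - a).val := by
  have hx := c.isLt
  have ha := a.isLt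
  have hb := b.isLt
  simp only [CycLt, val_sub_eq]
  split_ifs <;> omega

theorem cycIco_disjoint {a b c : Fin n} (h : CycLt a c b) :
    Disjoint (cycIco a c) (cycIco c b) := by
  rw [Finset.disjoint_left]
  intro x h1 h2
  rw [mem_cycIco] at h1 h2
  unfold CycLt at h
  omega

theorem cycIco_union {a b c : Fin n} (h : CycLt a c b) :
    cycIco a b = cycIco a c ∪ cycIco c b := by
  ext x
  have hx := x.isLt
  rw [Finset.mem_union, mem_cycIco, mem_cycIco, mem_cycIco]
  unfold CycLt at h
  omega

theorem cycIco_disjoint_swap (a b : Fin n) : Disjoint (cycIco a b) (cycIco b a) := by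
  rw [Finset.disjoint_left]
  intro x h1 h2
  rw [mem_cycIco] at h1 h2
  omega

theorem cycIco_union_swap {a b : Fin n} (h : a ≠ b) :
    cycIco a b ∪ cycIco b a = Finset.univ := by
  ext x
  have h' : a.val ≠ b.val := fun h' => h (Fin.ext h')
  simp only [Finset.mem_union, mem_cycIco, Finset.mem_univ, iff_true]
  omega

theorem cycIco_of_sub_eq_one {a b : Fin n} (h : (b - a).val = 1) : cycIco a b = {a} := by
  ext x
  have hx := x.isLt
  have ha := a.isLt
  have hb := b.isLt
  rw [mem_cycIco, Finset.mem_singleton, Fin.ext_iff]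
  rw [val_sub_eq] at h
  split_ifs at h <;> omega

theorem sum_cycIco_add {M : Type*} [AddCommMonoid M] {a b c : Fin n} (h : CycLt a c b)
    (f : Fin n → M) :
    ∑ i ∈ cycIco a b, f i = ∑ i ∈ cycIco a c, f i + ∑ i ∈ cycIco c b, f i := by
  rw [cycIco_union h, Finset.sum_union (cycIco_disjoint h)]

theorem sum_cycIco_add_swap {M : Type*} [AddCommMonoid M] {a b : Fin n} (h : a ≠ b)
    (f : Fin n → M) :
    ∑ i ∈ cycIco a b, f i + ∑ i ∈ cycIco b a, f i = ∑ i, f i := by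
  rw [← cycIco_union_swap h, Finset.sum_union (cycIco_disjoint_swap a b)]

theorem sum_cycIco_of_sub_eq_one {M : Type*} [AddCommMonoid M] {a b : Fin n}
    (h : (b - a).val = 1) (f : Fin n → M) : ∑ i ∈ cycIco a b, f i = f a := by
  rw [cycIco_of_sub_eq_one h, Finset.sum_singleton]

/-- The vertex before `b`. -/
theorem exists_sub_eq_one (hn : 2 ≤ n) (b : Fin n) : ∃ c : Fin n, (b - c).val = 1 := by
  have hb := b.isLt
  by_cases h : b.val = 0
  · refine ⟨⟨n - 1, by omega⟩, ?_⟩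
    rw [val_sub_eq]; simp only; split_ifs <;> omega
  · refine ⟨⟨b.val - 1, by omega⟩, ?_⟩
    rw [val_sub_eq]; simp only; split_ifs <;> omega

/-- The vertex after `a`. -/
theorem exists_sub_eq_one' (hn : 2 ≤ n) (a : Fin n) : ∃ c : Fin n, (c - a).val = 1 := by
  have hb := a.isLt
  by_cases h : a.val = n - 1
  · refine ⟨⟨0, by omega⟩, ?_⟩
    rw [val_sub_eq]; simp only; split_ifs <;> omega
  · refine ⟨⟨a.val + 1, by omega⟩, ?_⟩
    rw [val_sub_eq]; simp only; split_ifs <;> omega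

/-- Induction on the length of an arc. -/
theorem cyc_induction {P : Fin n → Fin n → Prop}
    (base : ∀ a b, (b - a).val = 1 → P a b)
    (step : ∀ a c b, CycLt a c b → P a c → P c b → P a b) (a b : Fin n) (hab : a ≠ b) :
    P a b := by
  have hv : a.val ≠ b.val := fun h => hab (Fin.ext h)
  have hn : 2 ≤ n := by have := a.isLt; have := b.isLt; omega
  obtain ⟨m, hm⟩ : ∃ m, (b - a).val = m := ⟨_, rfl⟩
  induction m using Nat.strong_induction_on generalizing a b with
  | _ m ih =>
    by_cases h1 : m = 1
    · exact base a b (hm.trans h1)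
    obtain ⟨c, hc⟩ := exists_sub_eq_one hn b
    have ha := a.isLt
    have hb := b.isLt
    have hcl := c.isLt
    have hlt : CycLt a c b := by
      unfold CycLt
      rw [val_sub_eq] at hm hc
      split_ifs at hm hc <;> omega
    refine step a c b hlt (ih (c - a).val ?_ a c hlt.ne.1 ?_ rfl) (base c b hc)
    · rw [← hm]; exact (cycLt_iff_sub.1 hlt).2
    · exact fun h => hlt.ne.1 (Fin.ext h)

/-- Cyclic indexing merges the two clauses of the definition: the last label is followed by the
first. -/
theorem mem_cDes {w : Equiv.Perm (Fin n)} {a b : Fin n} (h : (b - a).val = 1) :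
    a ∈ cDes w ↔ w.symm b < w.symm a := by
  have ha := a.isLt
  have hb := b.isLt
  rw [val_sub_eq] at h
  simp only [cDes, Finset.mem_filter, Finset.mem_univ, true_and]
  constructor
  · rintro (⟨j, hj, hlt⟩ | ⟨hn, j, hj, hlt⟩)
    · have : j = b := by apply Fin.ext; have := j.isLt; split_ifs at h <;> omega
      exact this ▸ hlt
    · have : j = b := by apply Fin.ext; split_ifs at h <;> omega
      exact this ▸ hlt
  · intro hlt
    split_ifs at h with hab
    · exact Or.inl ⟨b, by omega, hlt⟩
    · exact Or.inr ⟨by omega, b, by omega, hlt⟩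

/-- Telescoping: only the step from the last index back to the first contributes `t`, and an arc
contains this step iff `b < a`. It serves both for positions in a word (`t = 1`) and for labels (`t
= k + 1`). -/
theorem sum_cycIco_gap {g : Fin n → ℝ} {gap : Fin n → ℝ} {t : ℝ}
    (hgap : ∀ p q : Fin n, (q - p).val = 1 → gap p = g q - g p + if q < p then t else 0)
    {a b : Fin n} (hab : a ≠ b) :
    ∑ p ∈ cycIco a b, gap p = g b - g a + if b < a then t else 0 := by
  refine cyc_induction (P := fun a b => ∑ p ∈ cycIco a b, gap p =
    g b - g a + if b < a then t else 0) ?_ ?_ a b hab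
  · intro a b h
    rw [sum_cycIco_of_sub_eq_one h, hgap a b h]
  · intro a c b h h1 h2
    rw [sum_cycIco_add h, h1, h2]
    have : (if c < a then t else 0) + (if b < c then t else 0) = if b < a then t else 0 := by
      unfold CycLt at h
      simp only [Fin.lt_def]
      split_ifs <;> first | (exfalso; omega) | simp
    linarith

end Cyclic

/-! ### Descents of rotations and winding numbers. -/

section Words

variable {n : ℕ} [NeZero n]

theorem rotateTo_symm (w : Equiv.Perm (Fin n)) (r x : Fin n) :
    (rotateTo w r).symm x = w.symm x - (w.symm r + 1) := by
  rw [Equiv.symm_apply_eq]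
  simp only [rotateTo, Equiv.trans_apply, Equiv.coe_addRight, sub_add_cancel,
    Equiv.apply_symm_apply]

theorem val_rotateTo_symm (w : Equiv.Perm (Fin n)) (r x : Fin n) :
    ((rotateTo w r).symm x).val = if (w.symm r).val < (w.symm x).val
      then (w.symm x).val - (w.symm r).val - 1
      else n + (w.symm x).val - (w.symm r).val - 1 := by
  have hr := (w.symm r).isLt
  have hx := (w.symm x).isLt
  have h1 : (w.symm r + 1).val = if (w.symm r).val + 1 = n then 0 else (w.symm r).val + 1 := by
    rw [Fin.val_add, Fin.val_one', Nat.add_mod_mod]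
    split_ifs with h
    · rw [h, Nat.mod_self]
    · exact Nat.mod_eq_of_lt (by omega)
  rw [rotateTo_symm, val_sub_eq, h1]
  split_ifs <;> omega

/-- The rotation cuts the circle just after `r`; the letter `b` comes before `a` iff this cut is
crossed on the way forward from `a` to `b`. -/
theorem rotateTo_symm_lt_iff {w : Equiv.Perm (Fin n)} {r a b : Fin n} :
    (rotateTo w r).symm b < (rotateTo w r).symm a ↔
      w.symm r ∈ cycIco (w.symm a) (w.symm b) := by
  have ha := (w.symm a).isLt
  have hb := (w.symm b).isLt
  have hr := (w.symm r).isLt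
  rw [Fin.lt_def, val_rotateTo_symm, val_rotateTo_symm, mem_cycIco]
  split_ifs <;> omega

theorem mem_cDes_rotateTo {w : Equiv.Perm (Fin n)} {r a b : Fin n} (h : (b - a).val = 1) :
    a ∈ cDes (rotateTo w r) ↔ w.symm r ∈ cycIco (w.symm a) (w.symm b) := by
  rw [mem_cDes h, rotateTo_symm_lt_iff]

theorem rotateTo_last (w : Equiv.Perm (Fin n)) {l : Fin n} (hl : l.val + 1 = n) :
    rotateTo w (w l) = w := by
  have : l + 1 = 0 := by
    apply Fin.ext
    rw [Fin.val_add, Fin.val_one', Nat.add_mod_mod, hl, Nat.mod_self]; rfl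
  ext x
  simp [rotateTo, this]

/-- The number of cyclic left descents in `[a, b - 1]` of a rotation of `w`. -/
def descCount (w : Equiv.Perm (Fin n)) (r a b : Fin n) : ℕ :=
  ∑ i ∈ cycIco a b, if i ∈ cDes (rotateTo w r) then 1 else 0

/-- The number of full turns made around the cycle `(w)` on the way `a, a + 1, …, b`. -/
def wind (w : Equiv.Perm (Fin n)) (a b : Fin n) : ℕ := descCount w b a b

/-- The walk from `a` to `b` consists of full turns and one partial arc. Each full turn crosses the
cut after `r` once; the partial arc crosses it iff `r` lies on it before `b`. Cutting at `b`
therefore counts full turns only, which is why `wind` uses `r = b`. -/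
theorem descCount_eq (w : Equiv.Perm (Fin n)) (r a b : Fin n) (hab : a ≠ b) :
    descCount w r a b =
      wind w a b + if w.symm r ∈ cycIco (w.symm a) (w.symm b) then 1 else 0 := by
  revert r
  refine cyc_induction (P := fun a b => ∀ r, descCount w r a b = wind w a b +
    if w.symm r ∈ cycIco (w.symm a) (w.symm b) then 1 else 0) ?_ ?_ a b hab
  · intro a b h r
    have hb : w.symm b ∉ cycIco (w.symm a) (w.symm b) := by rw [mem_cycIco]; omega
    simp only [wind, descCount, sum_cycIco_of_sub_eq_one h, mem_cDes_rotateTo h, if_neg hb,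
      zero_add]
  · intro a c b h h1 h2 r
    have e1 : ∀ r, descCount w r a b = descCount w r a c + descCount w r c b :=
      fun r => sum_cycIco_add h _
    rw [wind, e1, e1, h1, h2, h1, h2]
    have hac : (w.symm a).val ≠ (w.symm c).val := fun e =>
      h.ne.1 (w.symm.injective (Fin.ext e))
    have hcb : (w.symm c).val ≠ (w.symm b).val := fun e =>
      h.ne.2.1 (w.symm.injective (Fin.ext e))
    have hab : (w.symm a).val ≠ (w.symm b).val := fun e =>
      h.ne.2.2 (w.symm.injective (Fin.ext e))
    simp only [mem_cycIco]
    split_ifs <;> omega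

/-- The partial arcs from `a` to `c` and from `c` to `b` join to the partial arc from `a` to `b`,
with an extra full turn iff `c` is not on it. -/
theorem wind_add (w : Equiv.Perm (Fin n)) {a c b : Fin n} (h : CycLt a c b) :
    wind w a b = wind w a c + wind w c b +
      if CycLt (w.symm a) (w.symm c) (w.symm b) then 0 else 1 := by
  have e1 : descCount w b a b = descCount w b a c + descCount w b c b := sum_cycIco_add h _
  rw [wind, e1, descCount_eq _ _ _ _ h.ne.1, descCount_eq _ _ _ _ h.ne.2.1]
  have hac : (w.symm a).val ≠ (w.symm c).val := fun e =>
    h.ne.1 (w.symm.injective (Fin.ext e))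
  have hcb : (w.symm c).val ≠ (w.symm b).val := fun e =>
    h.ne.2.1 (w.symm.injective (Fin.ext e))
  have hab : (w.symm a).val ≠ (w.symm b).val := fun e =>
    h.ne.2.2 (w.symm.injective (Fin.ext e))
  by_cases hc : CycLt (w.symm a) (w.symm c) (w.symm b)
  · rw [if_pos hc]
    simp only [mem_cycIco]
    unfold CycLt at hc
    split_ifs <;> omega
  · rw [if_neg hc]
    simp only [mem_cycIco]
    unfold CycLt at hc
    split_ifs <;> omega

theorem wind_of_sub_eq_one (w : Equiv.Perm (Fin n)) {a b : Fin n} (h : (b - a).val = 1) :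
    wind w a b = 0 := by
  have hb : w.symm b ∉ cycIco (w.symm a) (w.symm b) := by rw [mem_cycIco]; omega
  simp only [wind, descCount, sum_cycIco_of_sub_eq_one h, mem_cDes_rotateTo h, if_neg hb]

/-- The two complementary partial arcs make exactly one further turn, so the count does not depend
on the cut. -/
theorem card_cDes_rotateTo (w : Equiv.Perm (Fin n)) (r : Fin n) {a b : Fin n} (hab : a ≠ b) :
    (cDes (rotateTo w r)).card = wind w a b + wind w b a + 1 := by
  have h : descCount w r a b + descCount w r b a = (cDes (rotateTo w r)).card := by
    rw [descCount, descCount, sum_cycIco_add_swap hab]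
    simp
  have hv : (w.symm a).val ≠ (w.symm b).val := fun e =>
    hab (w.symm.injective (Fin.ext e))
  rw [← h, descCount_eq _ _ _ _ hab, descCount_eq _ _ _ _ hab.symm]
  simp only [mem_cycIco]
  split_ifs <;> omega

theorem card_cDes (w : Equiv.Perm (Fin n)) {a b : Fin n} (hab : a ≠ b) :
    (cDes w).card = wind w a b + wind w b a + 1 := by
  have hn : 0 < n := Nat.pos_of_ne_zero (NeZero.ne n)
  rw [← card_cDes_rotateTo w (w ⟨n - 1, by omega⟩) hab, rotateTo_last]
  simp only; omega

end Words

/-! ### `w`-simplices -/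

section Simplex

variable {n : ℕ} [NeZero n]

theorem sum_cycIco_e_cDes (w : Equiv.Perm (Fin n)) (r a b : Fin n) :
    ∑ i ∈ cycIco a b, e (cDes (rotateTo w r)) i = (descCount w r a b : ℝ) := by
  simp [e, descCount]

theorem sum_mem_of_mem_wSimplex {w : Equiv.Perm (Fin n)} {x : Fin n → ℝ} (hx : x ∈ wSimplex w)
    (s : Finset (Fin n)) {l u : ℝ}
    (h : ∀ r, l ≤ ∑ i ∈ s, e (cDes (rotateTo w r)) i ∧
      ∑ i ∈ s, e (cDes (rotateTo w r)) i ≤ u) :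
    l ≤ ∑ i ∈ s, x i ∧ ∑ i ∈ s, x i ≤ u := by
  have hlin : IsLinearMap ℝ fun x : Fin n → ℝ => ∑ i ∈ s, x i :=
    ⟨fun x y => by simp [Finset.sum_add_distrib], fun c x => by simp [Finset.mul_sum]⟩
  have h1 : wSimplex w ⊆ (fun x : Fin n → ℝ => ∑ i ∈ s, x i) ⁻¹' Set.Icc l u := by
    refine convexHull_min ?_ ((convex_Icc l u).is_linear_preimage hlin)
    rintro _ ⟨r, rfl⟩
    exact h r
  exact h1 hx

theorem wind_le_of_mem_wSimplex {w : Equiv.Perm (Fin n)} {x : Fin n → ℝ} (hx : x ∈ wSimplex w)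
    {a b : Fin n} (hab : a ≠ b) :
    (wind w a b : ℝ) ≤ ∑ i ∈ cycIco a b, x i ∧ ∑ i ∈ cycIco a b, x i ≤ (wind w a b : ℝ) + 1 := by
  refine sum_mem_of_mem_wSimplex hx _ fun r => ?_
  rw [sum_cycIco_e_cDes, descCount_eq _ _ _ _ hab]
  split_ifs <;> push_cast <;> constructor <;> linarith

theorem sum_of_mem_wSimplex {w : Equiv.Perm (Fin n)} {x : Fin n → ℝ} (hx : x ∈ wSimplex w)
    {a b : Fin n} (hab : a ≠ b) :
    ∑ i, x i = (wind w a b : ℝ) + wind w b a + 1 := by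
  have h := sum_mem_of_mem_wSimplex hx Finset.univ (l := (wind w a b : ℝ) + wind w b a + 1)
    (u := (wind w a b : ℝ) + wind w b a + 1) fun r => by
      have : ∑ i, e (cDes (rotateTo w r)) i = ((cDes (rotateTo w r)).card : ℝ) := by simp [e]
      rw [this, card_cDes_rotateTo w r hab]
      push_cast
      exact ⟨le_rfl, le_rfl⟩
  exact le_antisymm h.2 h.1

theorem vertex_mem_wSimplex (w : Equiv.Perm (Fin n)) (r : Fin n) :
    e (cDes (rotateTo w r)) ∈ wSimplex w :=
  subset_convexHull _ _ ⟨r, rfl⟩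

theorem exists_mem_wSimplex_min (w : Equiv.Perm (Fin n)) (a b : Fin n) :
    ∃ x ∈ wSimplex w, ∑ i ∈ cycIco a b, x i = (wind w a b : ℝ) :=
  ⟨_, vertex_mem_wSimplex w b, by rw [sum_cycIco_e_cDes, wind]⟩

theorem exists_mem_wSimplex_max (w : Equiv.Perm (Fin n)) {a b : Fin n} (hab : a ≠ b) :
    ∃ x ∈ wSimplex w, ∑ i ∈ cycIco a b, x i = (wind w a b : ℝ) + 1 := by
  refine ⟨_, vertex_mem_wSimplex w a, ?_⟩
  have hv : (w.symm a).val ≠ (w.symm b).val := fun e =>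
    hab (w.symm.injective (Fin.ext e))
  have : w.symm a ∈ cycIco (w.symm a) (w.symm b) := by rw [mem_cycIco]; omega
  rw [sum_cycIco_e_cDes, descCount_eq _ _ _ _ hab, if_pos this]
  push_cast; rfl

theorem wind_eq_of_wSimplex_eq {w v : Equiv.Perm (Fin n)} (h : wSimplex w = wSimplex v)
    {a b : Fin n} (hab : a ≠ b) : wind w a b = wind v a b := by
  obtain ⟨x, hx, hxe⟩ := exists_mem_wSimplex_min w a b
  obtain ⟨y, hy, hye⟩ := exists_mem_wSimplex_min v a b
  have h1 := (wind_le_of_mem_wSimplex (h ▸ hx) hab).1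
  have h2 := (wind_le_of_mem_wSimplex (h.symm ▸ hy) hab).1
  rw [hxe] at h1
  rw [hye] at h2
  exact le_antisymm (by exact_mod_cast h2) (by exact_mod_cast h1)

/-- Place the letters at the points `θ` of a circle of length 1, in the order of `w`. The gaps after
the letters are the barycentric coordinates: `x i` is the length of the arc from `i` to `i + 1`, the
sum of the gaps whose cut makes `i` a descent. -/
theorem mem_wSimplex_of_position {w : Equiv.Perm (Fin n)} (hn : 2 ≤ n) {θ : Fin n → ℝ}
    (hθ : Monotone (θ ∘ w)) (hθ1 : ∀ i j, θ i ≤ θ j + 1) {x : Fin n → ℝ}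
    (hx : ∀ i j : Fin n, (j - i).val = 1 →
      x i = θ j - θ i + if w.symm j < w.symm i then 1 else 0) :
    x ∈ wSimplex w := by
  choose s hs using exists_sub_eq_one' hn
  set gap : Fin n → ℝ := fun p => θ (w (s p)) - θ (w p) + if s p < p then 1 else 0 with hgd
  have hgap : ∀ p q : Fin n, (q - p).val = 1 →
      gap p = θ (w q) - θ (w p) + if q < p then 1 else 0 := by
    intro p q h
    have : q = s p := sub_left_injective (Fin.ext (h.trans (hs p).symm))
    rw [this]
  have hnn : ∀ p, 0 ≤ gap p := by
    intro p
    simp only [hgd]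
    split_ifs with h
    -- This is the gap from the last position back to the first; `hθ1` keeps it nonnegative.
    · linarith [hθ1 (w p) (w (s p))]
    · have := hθ (not_lt.1 h)
      simp only [Function.comp] at this
      linarith
  have hsum : ∀ a b : Fin n, a ≠ b → ∑ p ∈ cycIco a b, gap p =
      θ (w b) - θ (w a) + if b < a then 1 else 0 :=
    fun a b hab => sum_cycIco_gap (g := fun p => θ (w p)) hgap hab
  have htot : ∑ p, gap p = 1 := by
    have hne : (⟨0, by omega⟩ : Fin n) ≠ ⟨1, by omega⟩ := by simp
    rw [← sum_cycIco_add_swap hne, hsum _ _ hne, hsum _ _ hne.symm]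
    simp only [Fin.lt_def, not_lt_zero, Nat.zero_lt_one, if_true, if_false]
    ring
  have hmem : ∑ p, gap p • e (cDes (rotateTo w (w p))) ∈ wSimplex w :=
    (convex_convexHull ℝ _).sum_mem (fun p _ => hnn p) htot
      fun p _ => vertex_mem_wSimplex w (w p)
  convert hmem using 1
  ext i
  have hne : w.symm i ≠ w.symm (s i) := by
    intro h
    have h1 := hs i
    rw [← w.symm.injective h, val_sub_eq] at h1
    simp at h1
  rw [hx i (s i) (hs i), Finset.sum_apply]
  have := hsum _ _ hne
  simp only [Equiv.apply_symm_apply] at this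
  rw [← this]
  simp only [Pi.smul_apply, e, mem_cDes_rotateTo (hs i), Equiv.symm_apply_apply, smul_eq_mul,
    mul_ite, mul_one, mul_zero]
  rw [← Finset.sum_filter]
  simp

end Simplex

/-! ### Words and cyclic orders -/

section Orders

variable {n : ℕ}

theorem sublist_ofFn_iff {w : Equiv.Perm (Fin n)} {l : List (Fin n)} :
    l.Sublist (List.ofFn w) ↔ l.Pairwise fun x y => w.symm x < w.symm y := by
  constructor
  · intro h
    refine List.Pairwise.sublist h ?_
    rw [List.pairwise_ofFn]
    intro i j hij
    simpa using hij
  · intro h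
    have h1 : (l.map w.symm).SortedLT := (List.pairwise_map.2 h).sortedLT
    have h2 : (l.map w.symm).Sublist (List.finRange n) :=
      List.sublist_of_subperm_of_sortedLE (List.subperm_of_subset h1.nodup fun x _ => List.mem_finRange x)
        h1.sortedLE (List.sortedLT_finRange n).sortedLE
    have h3 := h2.map w
    rw [List.map_map, ← List.ofFn_eq_map] at h3
    simpa using h3

theorem triple_sublist_ofFn_iff {w : Equiv.Perm (Fin n)} {a b c : Fin n} :
    [a, b, c].Sublist (List.ofFn w) ↔ w.symm a < w.symm b ∧ w.symm b < w.symm c := by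
  rw [sublist_ofFn_iff]
  simp only [List.pairwise_cons, List.mem_cons, List.not_mem_nil, or_false, forall_eq_or_imp,
    forall_eq, List.Pairwise.nil, and_true, IsEmpty.forall_iff, implies_true]
  constructor
  · rintro ⟨⟨h1, _⟩, h2⟩; exact ⟨h1, h2⟩
  · rintro ⟨h1, h2⟩; exact ⟨⟨h1, h1.trans h2⟩, h2⟩

theorem mem_wOrder {w : Equiv.Perm (Fin n)} {a b c : Fin n} :
    (a, b, c) ∈ wOrder w ↔ CycLt (w.symm a) (w.symm b) (w.symm c) := by
  simp only [wOrder, chain, Set.mem_ofPred_eq, triple_sublist_ofFn_iff, CycLt, Fin.lt_def]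

theorem triple_sublist_iff_of_sortedLT {l : List (Fin n)} (hl : l.SortedLT) {a b c : Fin n} :
    [a, b, c].Sublist l ↔ (a ∈ l ∧ b ∈ l ∧ c ∈ l) ∧ a < b ∧ b < c := by
  constructor
  · intro h
    have hp := hl.pairwise.sublist h
    simp only [List.pairwise_cons, List.mem_cons, List.not_mem_nil, or_false, forall_eq_or_imp,
      forall_eq] at hp
    exact ⟨⟨h.subset (by simp), h.subset (by simp), h.subset (by simp)⟩, hp.1.1, hp.2.1⟩
  · rintro ⟨⟨ha, hb, hc⟩, hab, hbc⟩
    have hs : [a, b, c].SortedLT := by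
      refine List.Pairwise.sortedLT ?_
      simp [hab, hbc, hab.trans hbc]
    refine List.sublist_of_subperm_of_sortedLE (List.subperm_of_subset hs.nodup ?_)
      hs.sortedLE hl.sortedLE
    simp [ha, hb, hc]

theorem mem_chain_clockwise {P : Finset (Fin n)} {a b c : Fin n} :
    (a, b, c) ∈ chain (clockwise P) ↔ (a ∈ P ∧ b ∈ P ∧ c ∈ P) ∧ CycLt a b c := by
  simp only [chain, clockwise, Set.mem_ofPred_eq,
    triple_sublist_iff_of_sortedLT (Finset.sortedLT_sort P), Finset.mem_sort, CycLt, Fin.lt_def]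
  tauto

theorem mem_chain_counterclockwise {P : Finset (Fin n)} {a b c : Fin n} :
    (a, b, c) ∈ chain (counterclockwise P) ↔ (a ∈ P ∧ b ∈ P ∧ c ∈ P) ∧ CycLt c b a := by
  simp only [chain, counterclockwise, clockwise, Set.mem_ofPred_eq, List.sublist_reverse_iff,
    List.reverse_cons, List.reverse_nil, List.nil_append, List.cons_append,
    triple_sublist_iff_of_sortedLT (Finset.sortedLT_sort P), Finset.mem_sort, CycLt, Fin.lt_def]
  tauto

theorem isTotalCyclicOrder_wOrder (w : Equiv.Perm (Fin n)) :
    IsTotalCyclicOrder (wOrder w) where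
  cyclicity a b c h := by
    rw [mem_wOrder] at *; exact h.rotate
  asymmetry a b c h := by
    rw [mem_wOrder] at *; unfold CycLt at *; omega
  transitivity a b c d h h' := by
    rw [mem_wOrder] at *; unfold CycLt at *; omega
  total a b c hab hbc hac := by
    rw [mem_wOrder, mem_wOrder]
    have h1 : (w.symm a).val ≠ (w.symm b).val := fun e => hab (w.symm.injective (Fin.ext e))
    have h2 : (w.symm b).val ≠ (w.symm c).val := fun e => hbc (w.symm.injective (Fin.ext e))
    have h3 : (w.symm a).val ≠ (w.symm c).val := fun e => hac (w.symm.injective (Fin.ext e))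
    unfold CycLt; omega

/-- Total cyclic orders are maximal: a triple of `C'` missing from `C` has its reversal in `C`,
against the asymmetry of `C'`. -/
theorem IsTotalCyclicOrder.eq_of_subset {X : Type*} {C C' : Set (X × X × X)}
    (h : IsTotalCyclicOrder C) (h' : IsTotalCyclicOrder C') (hs : C ⊆ C') : C = C' := by
  refine hs.antisymm ?_
  rintro ⟨a, b, c⟩ habc
  have hab : ∀ x y, (x, x, y) ∉ C' := fun x y hxy =>
    h'.asymmetry _ _ _ (h'.cyclicity _ _ _ hxy) hxy
  have h1 : a ≠ b := by rintro rfl; exact hab _ _ habc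
  have h2 : b ≠ c := by
    rintro rfl
    exact hab _ _ (h'.cyclicity _ _ _ (h'.cyclicity _ _ _ habc))
  have h3 : a ≠ c := by rintro rfl; exact hab _ _ (h'.cyclicity _ _ _ habc)
  rcases h.total a b c h1 h2 h3 with h4 | h4
  · exact h4
  · exact absurd (h'.cyclicity _ _ _ (h'.cyclicity _ _ _ (hs h4))) (fun h5 =>
      h'.asymmetry _ _ _ habc h5)

theorem cycLt_rotateTo_symm [NeZero n] {w : Equiv.Perm (Fin n)} {r a b c : Fin n} :
    CycLt ((rotateTo w r).symm a) ((rotateTo w r).symm b) ((rotateTo w r).symm c) ↔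
      CycLt (w.symm a) (w.symm b) (w.symm c) := by
  have ha := (w.symm a).isLt
  have hb := (w.symm b).isLt
  have hc := (w.symm c).isLt
  have hr := (w.symm r).isLt
  unfold CycLt
  rw [val_rotateTo_symm, val_rotateTo_symm, val_rotateTo_symm]
  split_ifs <;> omega

theorem wOrder_rotateTo [NeZero n] (w : Equiv.Perm (Fin n)) (r : Fin n) :
    wOrder (rotateTo w r) = wOrder w := by
  ext ⟨a, b, c⟩
  rw [mem_wOrder, mem_wOrder, cycLt_rotateTo_symm]

theorem chain_mono {X : Type*} {l l' : List X} (h : l.Sublist l') : chain l ⊆ chain l' := by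
  rintro t (h' | h' | h')
  · exact Or.inl (h'.trans h)
  · exact Or.inr (Or.inl (h'.trans h))
  · exact Or.inr (Or.inr (h'.trans h))

theorem seenInOrder_iff [NeZero n] {w : Equiv.Perm (Fin n)} {l : List (Fin n)} (hl : l.Nodup) :
    SeenInOrder w l ↔ chain l ⊆ wOrder w := by
  constructor
  · rintro ⟨r, hr⟩
    rw [← wOrder_rotateTo w r]
    exact chain_mono hr
  · intro h
    rcases l with _ | ⟨x, l⟩
    · exact ⟨0, List.nil_sublist _⟩
    -- The letter just before `x` in the cycle: this rotation starts with `x`, and then `(x, a, b)`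
    -- in cyclic order means that `a` precedes `b`.
    set r := w (w.symm x - 1) with hr
    have hx : (rotateTo w r).symm x = 0 := by
      rw [rotateTo_symm, hr, Equiv.symm_apply_apply, sub_add_cancel, sub_self]
    refine ⟨r, sublist_ofFn_iff.2 ?_⟩
    have hne : ∀ y ∈ l, ((rotateTo w r).symm y).val ≠ 0 := by
      intro y hy h0
      have : (rotateTo w r).symm y = (rotateTo w r).symm x := by
        rw [hx]; exact Fin.ext h0
      have := (rotateTo w r).symm.injective this
      exact (List.nodup_cons.1 hl).1 (this ▸ hy)
    rw [List.pairwise_cons]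
    constructor
    · intro y hy
      rw [hx, Fin.lt_def]
      exact Nat.pos_of_ne_zero (hne y hy)
    · rw [List.pairwise_iff_forall_sublist]
      intro a b hab
      have hm : (x, a, b) ∈ wOrder (rotateTo w r) := by
        rw [wOrder_rotateTo]
        exact h (Or.inl (hab.cons_cons x))
      rw [mem_wOrder, hx] at hm
      have h1 := hne b (hab.subset (by simp))
      rw [Fin.lt_def]
      unfold CycLt at hm
      rw [Fin.val_zero] at hm
      omega

/-- A strict total order on `Fin n` is the order of the letters in some word. -/
theorem exists_perm_of_strict_total {r : Fin n → Fin n → Prop}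
    (htrans : ∀ a b c, r a b → r b c → r a c) (hirr : ∀ a, ¬ r a a)
    (htot : ∀ a b, a ≠ b → r a b ∨ r b a) :
    ∃ w : Equiv.Perm (Fin n), ∀ a b, w.symm a < w.symm b ↔ r a b := by
  classical
  have hlt : ∀ a, (Finset.univ.filter fun y => r y a).card < n := by
    intro a
    have : (Finset.univ.filter fun y => r y a) ⊂ Finset.univ :=
      Finset.ssubset_univ_iff.2 fun h => by
        have := Finset.mem_univ a
        rw [← h, Finset.mem_filter] at this
        exact hirr a this.2
    simpa using Finset.card_lt_card this
  -- The position of a letter is the number of letters below it.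
  set f : Fin n → Fin n := fun a => ⟨(Finset.univ.filter fun y => r y a).card, hlt a⟩ with hf
  have hmono : ∀ a b, r a b → f a < f b := by
    intro a b hab
    rw [Fin.lt_def]
    change (Finset.univ.filter fun y => r y a).card < (Finset.univ.filter fun y => r y b).card
    refine Finset.card_lt_card ⟨fun y hy => ?_, fun h => ?_⟩
    · simp only [Finset.mem_filter, Finset.mem_univ, true_and] at hy ⊢
      exact htrans _ _ _ hy hab
    · have : a ∈ Finset.univ.filter fun y => r y b := by simpa using hab
      have := h this
      simp only [Finset.mem_filter, Finset.mem_univ, true_and] at this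
      exact hirr a this
  have hinj : Function.Injective f := by
    intro a b hab
    by_contra hne
    rcases htot a b hne with h | h
    · exact (hmono _ _ h).ne hab
    · exact (hmono _ _ h).ne hab.symm
  refine ⟨(Equiv.ofBijective f (Finite.injective_iff_bijective.1 hinj)).symm, fun a b => ?_⟩
  simp only [Equiv.symm_symm, Equiv.ofBijective_apply]
  refine ⟨fun h => ?_, hmono a b⟩
  by_contra hab
  have hne : a ≠ b := by rintro rfl; exact lt_irrefl _ h
  rcases htot a b hne with h' | h'
  · exact hab h'
  · exact (hmono _ _ h').not_gt h

theorem DAll_iff {w : Equiv.Perm (Fin n)} :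
    w ∈ DAll n ↔ ∀ l x : Fin n, l.val + 1 = n → x ≠ l → w.symm x < w.symm l := by
  constructor
  · intro h l x hl hx
    have h1 := h l hl
    have h2 : w.symm l = l := by rw [Equiv.symm_apply_eq]; exact h1.symm
    have h3 : w.symm x ≠ l := fun h3 => hx (by rw [← h1, ← h3, Equiv.apply_symm_apply])
    have h4 : (w.symm x).val ≠ l.val := fun h4 => h3 (Fin.ext h4)
    have h5 := (w.symm x).isLt
    rw [h2, Fin.lt_def]
    omega
  · intro h l hl
    by_contra hne
    have h1 := h l (w l) hl hne
    rw [Equiv.symm_apply_apply, Fin.lt_def] at h1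
    have h2 := (w.symm l).isLt
    omega

/-- As the largest label `l` ends the word, the linear order is read off the cyclic one: `a`
precedes `b` iff `b = l` or `(a, b, l)` is a triple, for `a ≠ b` and `a ≠ l`. -/
theorem injOn_wOrder (hn : 2 ≤ n) : Set.InjOn (wOrder (n := n)) (DAll n) := by
  intro w hw v hv hwv
  have hl : n - 1 + 1 = n := by omega
  set l : Fin n := ⟨n - 1, by omega⟩ with hld
  have key : ∀ u : Equiv.Perm (Fin n), u ∈ DAll n → ∀ a b, u.symm a < u.symm b ↔
      a ≠ b ∧ a ≠ l ∧ (b = l ∨ (a, b, l) ∈ wOrder u) := by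
    intro u hu a b
    rw [DAll_iff] at hu
    have ha := hu l a hl
    have hb := hu l b hl
    rw [mem_wOrder]
    constructor
    · intro h
      have hal : a ≠ l := by
        rintro rfl
        by_cases hbl : b = l
        · exact lt_irrefl _ (hbl ▸ h)
        · exact lt_asymm h (hb hbl)
      refine ⟨fun e => lt_irrefl _ (e ▸ h), hal, ?_⟩
      by_cases hbl : b = l
      · exact Or.inl hbl
      · exact Or.inr (Or.inl ⟨h, hb hbl⟩)
    · rintro ⟨-, hal, rfl | h⟩
      · exact ha hal
      · have := ha hal
        rw [Fin.lt_def] at *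
        unfold CycLt at h
        omega
  have hiff : ∀ a b, w.symm a < w.symm b ↔ v.symm a < v.symm b := by
    intro a b
    rw [key w hw, key v hv, hwv]
  have hmono : StrictMono (v.trans w.symm) := by
    intro p q hpq
    simp only [Equiv.trans_apply]
    rw [hiff]
    simpa using hpq
  have hsurj := (v.trans w.symm).surjective
  have hid : ⇑(v.trans w.symm) = id := by
    have := Subsingleton.elim (hmono.orderIsoOfSurjective _ hsurj) (OrderIso.refl (Fin n))
    funext p
    exact congrArg (fun g : Fin n ≃o Fin n => g p) this
  ext p
  have := congrFun hid p
  simp only [Equiv.trans_apply, id, Equiv.symm_apply_eq] at this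
  rw [this]

/-- Cutting `C` after the largest label `l` yields a strict total order in which `l` comes last. -/
theorem exists_wOrder_eq (hn : 2 ≤ n) {C : Set (Fin n × Fin n × Fin n)}
    (hC : IsTotalCyclicOrder C) : ∃ w ∈ DAll n, wOrder w = C := by
  have hl : n - 1 + 1 = n := by omega
  set l : Fin n := ⟨n - 1, by omega⟩ with hld
  have hcyc := hC.cyclicity
  have hirr : ∀ x y, (x, x, y) ∉ C := fun x y hxy =>
    hC.asymmetry _ _ _ (hcyc _ _ _ hxy) hxy
  obtain ⟨w, hw⟩ := exists_perm_of_strict_total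
    (r := fun a b : Fin n => a ≠ l ∧ (b = l ∨ (a, b, l) ∈ C)) (by
      rintro a b c ⟨ha, h1⟩ ⟨hb, h2⟩
      refine ⟨ha, h2.imp id fun h2 => ?_⟩
      have h1 := h1.resolve_left hb
      exact hcyc _ _ _ (hcyc _ _ _ (hC.transitivity _ _ _ _ (hcyc _ _ _ h1) (hcyc _ _ _ h2))))
    (by
      rintro a ⟨ha, h | h⟩
      · exact ha h
      · exact hirr _ _ h)
    (by
      intro a b hab
      by_cases ha : a = l
      · exact Or.inr ⟨fun hb => hab (ha.trans hb.symm), Or.inl ha⟩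
      by_cases hb : b = l
      · exact Or.inl ⟨ha, Or.inl hb⟩
      rcases hC.total a b l hab hb ha with h | h
      · exact Or.inl ⟨ha, Or.inr h⟩
      · exact Or.inr ⟨hb, Or.inr (hcyc _ _ _ h)⟩)
  have hlin : ∀ a b c, w.symm a < w.symm b → w.symm b < w.symm c → (a, b, c) ∈ C := by
    intro a b c hab hbc
    rw [hw] at hab hbc
    have h1 := hab.2.resolve_left hbc.1
    rcases hbc.2 with rfl | h2
    · exact h1
    · exact hcyc _ _ _ (hC.transitivity _ _ _ _ h2 (hcyc _ _ _ (hcyc _ _ _ h1)))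
  refine ⟨w, DAll_iff.2 fun l' x hl' hx => ?_, ?_⟩
  · have : l' = l := Fin.ext (by simp only [hld]; omega)
    rw [hw]
    exact ⟨this ▸ hx, Or.inl this⟩
  · refine (isTotalCyclicOrder_wOrder w).eq_of_subset hC ?_
    rintro ⟨a, b, c⟩ h
    rw [mem_wOrder] at h
    rcases h with h | h | h
    · exact hlin _ _ _ h.1 h.2
    · exact hcyc _ _ _ (hlin _ _ _ h.1 h.2)
    · exact hcyc _ _ _ (hcyc _ _ _ (hlin _ _ _ h.1 h.2))

/-- A simplex determines the windings as minima of linear functionals; by `wind_add` they tell which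
clockwise triples the word preserves, hence the whole cyclic order. -/
theorem injOn_wSimplex [NeZero n] (hn : 2 ≤ n) : Set.InjOn (wSimplex (n := n)) (DAll n) := by
  intro w hw v hv hwv
  refine injOn_wOrder hn hw hv
    ((isTotalCyclicOrder_wOrder w).eq_of_subset (isTotalCyclicOrder_wOrder v) ?_)
  have hlt : ∀ a c b : Fin n, CycLt a c b → (CycLt (w.symm a) (w.symm c) (w.symm b) ↔
      CycLt (v.symm a) (v.symm c) (v.symm b)) := by
    intro a c b h
    have h1 := wind_add w h
    have h2 := wind_add v h
    rw [wind_eq_of_wSimplex_eq hwv h.ne.1, wind_eq_of_wSimplex_eq hwv h.ne.2.1,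
      wind_eq_of_wSimplex_eq hwv h.ne.2.2] at h1
    split_ifs at h1 h2 <;> 
      first
      | omega
      | exact iff_of_true ‹_› ‹_›
      | exact iff_of_false ‹_› ‹_›
  rintro ⟨a, c, b⟩ h
  have hne := mem_wOrder.1 h
  by_cases h1 : CycLt a c b
  · rw [mem_wOrder] at *
    exact (hlt a c b h1).1 h
  · have hac : a ≠ c := by rintro rfl; exact hne.ne.1 rfl
    have hcb : c ≠ b := by rintro rfl; exact hne.ne.2.1 rfl
    have hab : a ≠ b := by rintro rfl; exact hne.ne.2.2 rfl
    have h2 : CycLt b c a := by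
      rw [ne_eq, Fin.ext_iff] at hac hcb hab
      unfold CycLt at *; omega
    rcases (isTotalCyclicOrder_wOrder v).total a c b hac hcb hab with h3 | h3
    · exact h3
    · exfalso
      rw [mem_wOrder] at h3
      have h4 := (hlt b c a h2).2 (by unfold CycLt at *; omega)
      unfold CycLt at *; omega

end Orders

/-! ### Areas in a bicolored subdivision -/

namespace BicoloredSubdivision

variable {n : ℕ} (σ : BicoloredSubdivision n)

/-- The polygons of `σ`. -/
abbrev polygons : Finset (Finset (Fin n)) := σ.white ∪ σ.black

variable {σ}

theorem Compatible.symm {a b : Fin n} (h : σ.Compatible a b) : σ.Compatible b a := by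
  obtain ⟨hne, P, hP, ha, hb⟩ := h
  exact ⟨hne.symm, P, hP, hb, ha⟩

theorem exists_chord {P Q : Finset (Fin n)} (hP : P ∈ σ.polygons) (hQ : Q ∈ σ.polygons)
    (h : P ≠ Q) : ∃ i j : Fin n, i.val ≠ j.val ∧ P ⊆ cycIcc i j ∧ Q ⊆ cycIcc j i := by
  obtain ⟨i, j, h1, h2⟩ := σ.separated P hP Q hQ h
  refine ⟨i, j, fun hij => ?_, h1, h2⟩
  obtain rfl : i = j := Fin.ext hij
  have h3 : cycIcc i i ⊆ {i} := by
    intro x hx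
    rw [mem_cycIcc] at hx
    rw [Finset.mem_singleton, Fin.ext_iff]
    omega
  have := Finset.card_le_card (h1.trans h3)
  have := σ.three_le_card P hP
  rw [Finset.card_singleton] at *
  omega

/-- A diagonal of a polygon has every other polygon on one side. -/
theorem subset_cycIcc_or {P Q : Finset (Fin n)} (hP : P ∈ σ.polygons) (hQ : Q ∈ σ.polygons)
    (h : P ≠ Q) {a b : Fin n} (ha : a ∈ P) (hb : b ∈ P) (hab : a ≠ b) :
    Q ⊆ cycIcc a b ∨ Q ⊆ cycIcc b a := by
  obtain ⟨i, j, hij, h1, h2⟩ := exists_chord hP hQ h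
  have hab : a.val ≠ b.val := fun e => hab (Fin.ext e)
  have ha := mem_cycIcc.1 (h1 ha)
  have hb := mem_cycIcc.1 (h1 hb)
  by_contra! hc
  obtain ⟨⟨x, hx, hx'⟩, ⟨y, hy, hy'⟩⟩ := hc.imp Finset.not_subset.1 Finset.not_subset.1
  have hx := mem_cycIcc.1 (h2 hx)
  have hy := mem_cycIcc.1 (h2 hy)
  rw [mem_cycIcc] at hx' hy'
  omega

/-- A triangle inside a polygon has every other polygon on the outer side of one of its edges. -/
theorem subset_cycIcc_or_or {P Q : Finset (Fin n)} (hP : P ∈ σ.polygons) (hQ : Q ∈ σ.polygons)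
    (h : P ≠ Q) {a c b : Fin n} (ha : a ∈ P) (hc : c ∈ P) (hb : b ∈ P) (hacb : CycLt a c b) :
    Q ⊆ cycIcc a c ∨ Q ⊆ cycIcc c b ∨ Q ⊆ cycIcc b a := by
  obtain ⟨i, j, hij, h1, h2⟩ := exists_chord hP hQ h
  have ha := mem_cycIcc.1 (h1 ha)
  have hb := mem_cycIcc.1 (h1 hb)
  have hc := mem_cycIcc.1 (h1 hc)
  -- All three vertices lie on `[i, j]`, so the complementary arc fits between two cyclically
  -- consecutive ones.
  have key : cycIcc j i ⊆ cycIcc a c ∨ cycIcc j i ⊆ cycIcc c b ∨ cycIcc j i ⊆ cycIcc b a := by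
    unfold CycLt at hacb
    have hi := i.isLt
    have hj := j.isLt
    have : (∀ x, x ∈ cycIcc j i → x ∈ cycIcc a c) ∨ (∀ x, x ∈ cycIcc j i → x ∈ cycIcc c b) ∨
        (∀ x, x ∈ cycIcc j i → x ∈ cycIcc b a) := by
      simp only [mem_cycIcc]
      rcases hacb with hl | hl | hl <;> rcases ha with ha | ha <;> rcases hb with hb | hb <;>
        rcases hc with hc | hc <;>
        first
        | (exfalso; omega)
        | (left; intro x hx; omega)
        | (right; left; intro x hx; omega)
        | (right; right; intro x hx; omega)
        | (rcases ha.2 with ha | ha <;> rcases hb.2 with hb | hb <;> rcases hc.2 with hc | hc <;>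
            first
            | (exfalso; omega)
            | (left; intro x hx; omega)
            | (right; left; intro x hx; omega)
            | (right; right; intro x hx; omega))
    exact this
  exact key.imp h2.trans (Or.imp h2.trans h2.trans)

theorem card_inter_le_two {Q s : Finset (Fin n)} {a b : Fin n}
    (h : ∀ x ∈ Q, x ∈ s → x.val = a.val ∨ x.val = b.val) : (Q ∩ s).card ≤ 2 := by
  have : Q ∩ s ⊆ {a, b} := by
    intro x hx
    rw [Finset.mem_inter] at hx
    rw [Finset.mem_insert, Finset.mem_singleton, Fin.ext_iff, Fin.ext_iff]
    exact h x hx.1 hx.2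
  exact (Finset.card_le_card this).trans Finset.card_le_two

theorem two_le_card_inter {P : Finset (Fin n)} {a b : Fin n} (ha : a ∈ P) (hb : b ∈ P)
    (hab : a ≠ b) : 2 ≤ (P ∩ cycIcc a b).card := by
  have h : ({a, b} : Finset (Fin n)) ⊆ P ∩ cycIcc a b := by
    intro x hx
    rw [Finset.mem_insert, Finset.mem_singleton] at hx
    rw [Finset.mem_inter, mem_cycIcc]
    rcases hx with rfl | rfl
    · exact ⟨ha, by omega⟩
    · exact ⟨hb, by omega⟩
  have := Finset.card_le_card h
  rwa [Finset.card_pair hab] at this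

theorem inter_cycIcc_congr {Q : Finset (Fin n)} {s t : Finset (Fin n)}
    (h : ∀ x ∈ Q, (x ∈ s ↔ x ∈ t)) : Q ∩ s = Q ∩ t := by
  ext x
  simp only [Finset.mem_inter]
  exact and_congr_right (h x)

/-- The triangle `a, c, b` is the only piece left of `a → b` lying left of neither `a → c` nor `c →
b`. In `P` the two vertex sets share just `c`, which leaves one more triangle; any other polygon
lies beyond one edge of the triangle. -/
theorem area_add {P : Finset (Fin n)} (hP : P ∈ σ.polygons) {a c b : Fin n} (ha : a ∈ P)
    (hc : c ∈ P) (hb : b ∈ P) (h : CycLt a c b) :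
    σ.area a b = σ.area a c + σ.area c b + if P ∈ σ.black then 1 else 0 := by
  have hite : (if P ∈ σ.black then 1 else 0) = ∑ Q ∈ σ.black, if Q = P then 1 else 0 := by
    rw [Finset.sum_ite_eq']
  rw [hite, area, area, area, ← Finset.sum_add_distrib, ← Finset.sum_add_distrib]
  refine Finset.sum_congr rfl fun Q hQ => ?_
  by_cases hQP : Q = P
  · subst hQP
    have hu : Q ∩ cycIcc a b = (Q ∩ cycIcc a c) ∪ (Q ∩ cycIcc c b) := by
      rw [← Finset.inter_union_distrib_left]
      refine inter_cycIcc_congr fun x _ => ?_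
      rw [Finset.mem_union, mem_cycIcc, mem_cycIcc, mem_cycIcc]
      unfold CycLt at h
      omega
    have hi : (Q ∩ cycIcc a c) ∩ (Q ∩ cycIcc c b) = {c} := by
      ext x
      simp only [Finset.mem_inter, mem_cycIcc, Finset.mem_singleton]
      unfold CycLt at h
      constructor
      · rintro ⟨⟨_, h1⟩, ⟨_, h2⟩⟩
        apply Fin.ext; omega
      · rintro rfl
        exact ⟨⟨hc, by omega⟩, hc, by omega⟩
    have hcard := Finset.card_union_add_card_inter (Q ∩ cycIcc a c) (Q ∩ cycIcc c b)
    rw [← hu, hi, Finset.card_singleton] at hcard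
    have h1 := two_le_card_inter ha hc h.ne.1
    have h2 := two_le_card_inter hc hb h.ne.2.1
    rw [if_pos rfl]
    omega
  · rw [if_neg hQP]
    unfold CycLt at h
    rcases subset_cycIcc_or_or hP (Finset.mem_union_right _ hQ) (Ne.symm hQP) ha hc hb h with
      hs | hs | hs
    · have h1 : Q ∩ cycIcc a b = Q ∩ cycIcc a c := by
        refine inter_cycIcc_congr fun x hx => ?_
        have := mem_cycIcc.1 (hs hx)
        rw [mem_cycIcc, mem_cycIcc]
        omega
      have h2 : (Q ∩ cycIcc c b).card ≤ 2 := by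
        refine card_inter_le_two (a := c) (b := c) fun x hx hx' => ?_
        have := mem_cycIcc.1 (hs hx)
        rw [mem_cycIcc] at hx'
        omega
      rw [h1]
      omega
    · have h1 : Q ∩ cycIcc a b = Q ∩ cycIcc c b := by
        refine inter_cycIcc_congr fun x hx => ?_
        have := mem_cycIcc.1 (hs hx)
        rw [mem_cycIcc, mem_cycIcc]
        omega
      have h2 : (Q ∩ cycIcc a c).card ≤ 2 := by
        refine card_inter_le_two (a := c) (b := c) fun x hx hx' => ?_
        have := mem_cycIcc.1 (hs hx)
        rw [mem_cycIcc] at hx'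
        omega
      rw [h1]
      omega
    · have h1 : (Q ∩ cycIcc a b).card ≤ 2 := by
        refine card_inter_le_two (a := a) (b := b) fun x hx hx' => ?_
        have := mem_cycIcc.1 (hs hx)
        rw [mem_cycIcc] at hx'
        omega
      have h2 : (Q ∩ cycIcc a c).card ≤ 2 := by
        refine card_inter_le_two (a := a) (b := a) fun x hx hx' => ?_
        have := mem_cycIcc.1 (hs hx)
        rw [mem_cycIcc] at hx'
        omega
      have h3 : (Q ∩ cycIcc c b).card ≤ 2 := by
        refine card_inter_le_two (a := b) (b := b) fun x hx hx' => ?_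
        have := mem_cycIcc.1 (hs hx)
        rw [mem_cycIcc] at hx'
        omega
      omega

theorem area_add_swap {a b : Fin n} (h : σ.Compatible a b) :
    σ.area a b + σ.area b a = σ.numBlackTriangles := by
  obtain ⟨hab, P, hP, ha, hb⟩ := h
  have hv : a.val ≠ b.val := fun e => hab (Fin.ext e)
  rw [area, area, numBlackTriangles, ← Finset.sum_add_distrib]
  refine Finset.sum_congr rfl fun Q hQ => ?_
  by_cases hQP : Q = P
  · subst hQP
    have hu : Q = (Q ∩ cycIcc a b) ∪ (Q ∩ cycIcc b a) := by
      rw [← Finset.inter_union_distrib_left, eq_comm, Finset.inter_eq_left]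
      intro x _
      rw [Finset.mem_union, mem_cycIcc, mem_cycIcc]
      omega
    have hi : (Q ∩ cycIcc a b) ∩ (Q ∩ cycIcc b a) = {a, b} := by
      ext x
      simp only [Finset.mem_inter, mem_cycIcc, Finset.mem_singleton, Finset.mem_insert]
      constructor
      · rintro ⟨⟨_, h1⟩, ⟨_, h2⟩⟩
        rw [Fin.ext_iff, Fin.ext_iff]
        omega
      · rintro (rfl | rfl)
        · exact ⟨⟨ha, by omega⟩, ha, by omega⟩
        · exact ⟨⟨hb, by omega⟩, hb, by omega⟩
    have hcard := Finset.card_union_add_card_inter (Q ∩ cycIcc a b) (Q ∩ cycIcc b a)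
    rw [← hu, hi, Finset.card_pair hab] at hcard
    have h1 := two_le_card_inter ha hb hab
    have h2 := two_le_card_inter hb ha hab.symm
    omega
  · have key : ∀ a b : Fin n, a.val ≠ b.val → Q ⊆ cycIcc a b →
        Q ∩ cycIcc a b = Q ∧ (Q ∩ cycIcc b a).card ≤ 2 := by
      intro a b hv hs
      refine ⟨Finset.inter_eq_left.2 hs, card_inter_le_two (a := a) (b := b) fun x hx hx' => ?_⟩
      have := mem_cycIcc.1 (hs hx)
      rw [mem_cycIcc] at hx'
      omega
    rcases subset_cycIcc_or hP (Finset.mem_union_right _ hQ) (Ne.symm hQP) ha hb hab with hs | hs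
    · obtain ⟨h1, h2⟩ := key a b hv hs
      rw [h1]; omega
    · obtain ⟨h1, h2⟩ := key b a hv.symm hs
      rw [h1]; omega

theorem area_of_sub_eq_one {a b : Fin n} (h : (b - a).val = 1) : σ.area a b = 0 := by
  refine Finset.sum_eq_zero fun Q _ => ?_
  have : (Q ∩ cycIcc a b).card ≤ 2 := by
    refine card_inter_le_two (a := a) (b := b) fun x _ hx' => ?_
    have hx := x.isLt
    have ha := a.isLt
    have hb := b.isLt
    rw [mem_cycIcc] at hx'
    rw [val_sub_eq] at h
    split_ifs at h <;> omega
  omega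

theorem compatible_of_sub_eq_one {a b : Fin n} (h : (b - a).val = 1) : σ.Compatible a b := by
  obtain ⟨P, hP, ha, hb⟩ := σ.cover_boundary a b h
  refine ⟨?_, P, hP, ha, hb⟩
  rintro rfl
  rw [val_sub_eq] at h
  simp at h

/-- Induction on compatible arcs: each is a side of the `n`-gon or the third edge of a triangle
lying in a polygon. -/
theorem compatible_induction {M : Fin n → Fin n → Prop}
    (base : ∀ a b, (b - a).val = 1 → M a b)
    (step : ∀ P ∈ σ.polygons, ∀ a ∈ P, ∀ c ∈ P, ∀ b ∈ P, CycLt a c b → M a c → M c b → M a b)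
    {a b : Fin n} (hab : σ.Compatible a b) : M a b := by
  obtain ⟨m, hm⟩ : ∃ m, (b - a).val = m := ⟨_, rfl⟩
  induction m using Nat.strong_induction_on generalizing a b with
  | _ m ih =>
    obtain ⟨hne, P, hP, ha, hb⟩ := hab
    have hv : a.val ≠ b.val := fun e => hne (Fin.ext e)
    by_cases h1 : m = 1
    · exact base a b (hm.trans h1)
    have h2 : 1 < (b - a).val := by
      have ha := a.isLt
      have hb := b.isLt
      rw [val_sub_eq] at *
      split_ifs at * <;> omega
    obtain ⟨Q, hQ, ha, hb, c, hc, hc1, hc2⟩ := σ.cover_left P hP a ha b hb h2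
    have hlt : CycLt a c b := cycLt_iff_sub.2 ⟨hc1, hc2⟩
    refine step Q hQ a ha c hc b hb hlt (ih _ (hm ▸ hc2) ⟨hlt.ne.1, Q, hQ, ha, hc⟩ rfl)
      (ih _ ?_ ⟨hlt.ne.2.1, Q, hQ, hc, hb⟩ rfl)
    have ha := a.isLt
    have hb := b.isLt
    have hc := c.isLt
    rw [val_sub_eq] at *
    unfold CycLt at hlt
    split_ifs at * <;> omega

end BicoloredSubdivision

/-! ### Points satisfying the tile inequalities strictly. -/

namespace BicoloredSubdivision

variable {n : ℕ} {σ : BicoloredSubdivision n}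

/-- Partial sums along an arc that satisfy all inequalities of the tile strictly. -/
theorem exists_partialSums {a b : Fin n} (hab : σ.Compatible a b) :
    a.val < b.val → ∀ r : ℝ, 0 < r → r < 1 → ∃ Y : Fin n → ℝ, Y a = 0 ∧ Y b = σ.area a b + r ∧
      ∀ d e : Fin n, a.val ≤ d.val → d.val < e.val → e.val ≤ b.val → σ.Compatible d e →
        (σ.area d e : ℝ) < Y e - Y d ∧ Y e - Y d < σ.area d e + 1 := by
  refine compatible_induction (M := fun a b => a.val < b.val → ∀ r : ℝ, 0 < r → r < 1 →
    ∃ Y : Fin n → ℝ, Y a = 0 ∧ Y b = σ.area a b + r ∧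
      ∀ d e : Fin n, a.val ≤ d.val → d.val < e.val → e.val ≤ b.val → σ.Compatible d e →
        (σ.area d e : ℝ) < Y e - Y d ∧ Y e - Y d < σ.area d e + 1) ?_ ?_ hab
  · intro a b h hlt r hr0 hr1
    have hne : a ≠ b := by rintro rfl; omega
    refine ⟨fun x => if x = b then r else 0, if_neg hne, ?_, ?_⟩
    · rw [area_of_sub_eq_one h]; simp
    · intro d e had hde heb _
      have hab : b.val = a.val + 1 := by
        rw [val_sub_eq, if_pos hlt.le] at h; omega
      obtain rfl : d = a := Fin.ext (by omega)
      obtain rfl : e = b := Fin.ext (by omega)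
      simp only [area_of_sub_eq_one h, if_true, if_neg hne]
      constructor <;> push_cast <;> linarith
  · intro Q hQ a ha c hc b hb hacb ih1 ih2 hlt r hr0 hr1
    have hac : a.val < c.val := by unfold CycLt at hacb; omega
    have hcb : c.val < b.val := by unfold CycLt at hacb; omega
    obtain ⟨β, hβ, hβ'⟩ : ∃ β : ℝ, (β = 0 ∨ β = 1) ∧ ∀ x ∈ Q, ∀ z ∈ Q, ∀ y ∈ Q, CycLt x z y →
        (σ.area x y : ℝ) = σ.area x z + σ.area z y + β := by
      refine ⟨if Q ∈ σ.black then 1 else 0, by split_ifs <;> simp, fun x hx z hz y hy h => ?_⟩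
      rw [area_add hQ hx hz hy h]
      push_cast; rfl
    -- Call `Y e - Y d - area d e` the excess of `d → e`. By additivity of the area the excesses of
    -- `a → c` and `c → b` must add up to `r + β`; both are chosen equal, and half of `r + β` lies
    -- in `(0, 1)`.
    set s : ℝ := (r + β) / 2 with hs
    have hs0 : 0 < s := by rcases hβ with h | h <;> rw [hs, h] <;> linarith
    have hs1 : s < 1 := by rcases hβ with h | h <;> rw [hs, h] <;> linarith
    obtain ⟨Y1, h1a, h1c, h1⟩ := ih1 hac s hs0 hs1
    obtain ⟨Y2, h2c, h2b, h2⟩ := ih2 hcb s hs0 hs1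
    set Y : Fin n → ℝ := fun x => if x.val ≤ c.val then Y1 x else σ.area a c + s + Y2 x with hY
    have hY1 : ∀ x : Fin n, x.val ≤ c.val → Y x = Y1 x := fun x hx => if_pos hx
    have hY2 : ∀ x : Fin n, c.val ≤ x.val → Y x = σ.area a c + s + Y2 x := by
      intro x hx
      by_cases h : x.val ≤ c.val
      · obtain rfl : x = c := Fin.ext (by omega)
        rw [hY1 _ le_rfl, h1c, h2c, add_zero]
      · exact if_neg h
    have hYa : Y a = 0 := by rw [hY1 a hac.le, h1a]
    have hYc : Y c = σ.area a c + s := by rw [hY1 c le_rfl, h1c]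
    have hYb : Y b = σ.area a b + r := by
      rw [hY2 b hcb.le, h2b, hβ' a ha c hc b hb hacb]
      linarith
    have hleft : ∀ d e : Fin n, a.val ≤ d.val → d.val < e.val → e.val ≤ c.val →
        σ.Compatible d e → (σ.area d e : ℝ) < Y e - Y d ∧ Y e - Y d < σ.area d e + 1 := by
      intro d e had hde hec hcomp
      rw [hY1 d (by omega), hY1 e hec]
      exact h1 d e had hde hec hcomp
    have hright : ∀ d e : Fin n, c.val ≤ d.val → d.val < e.val → e.val ≤ b.val →
        σ.Compatible d e → (σ.area d e : ℝ) < Y e - Y d ∧ Y e - Y d < σ.area d e + 1 := by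
      intro d e hcd hde heb hcomp
      rw [hY2 d hcd, hY2 e (by omega)]
      have := h2 d e hcd hde heb hcomp
      constructor <;> linarith
    refine ⟨Y, hYa, hYb, ?_⟩
    intro d e had hde heb hcomp
    by_cases hec : e.val ≤ c.val
    · exact hleft d e had hde hec hcomp
    by_cases hcd : c.val ≤ d.val
    · exact hright d e hcd hde heb hcomp
    obtain ⟨hne, P, hP, hd, he⟩ := hcomp
    by_cases hPQ : P = Q
    · subst hPQ
      have hdc : d ≠ c := by rintro rfl; omega
      have hce : c ≠ e := by rintro rfl; omega
      have hdce := hβ' d hd c hc e he (by unfold CycLt; omega)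
      have b1 := hleft d c had (by omega) le_rfl ⟨hdc, P, hP, hd, hc⟩
      have b2 := hright c e le_rfl (by omega) heb ⟨hce, P, hP, hc, he⟩
      -- Replacing `a` by a later vertex `d` of the same polygon lowers the excess if it is white
      -- and raises it if it is black. So the excess of `d → e`, the sum of those of `d → c` and `c
      -- → e` minus `β`, is at most `2s = r` or at least `2s - 1 = r`, respectively.
      have k1 : (β = 0 → Y c - Y d - σ.area d c ≤ s) ∧ (β = 1 → s ≤ Y c - Y d - σ.area d c) := by
        by_cases hda : a.val = d.val
        · obtain rfl : a = d := Fin.ext hda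
          rw [hYa, hYc]
          exact ⟨fun _ => by linarith, fun _ => by linarith⟩
        · have hadne : a ≠ d := fun e => hda (congrArg Fin.val e)
          have := hleft a d le_rfl (by omega) (by omega) ⟨hadne, P, hP, ha, hd⟩
          have h3 := hβ' a ha d hd c hc (by unfold CycLt; omega)
          rw [hYa] at this
          rw [hYc]
          constructor <;> intro h <;> rw [h] at h3 <;> linarith
      have k2 : (β = 0 → Y e - Y c - σ.area c e ≤ s) ∧ (β = 1 → s ≤ Y e - Y c - σ.area c e) := by
        have hbc : Y b - Y c = σ.area c b + s := by
          rw [hYb, hYc, hβ' a ha c hc b hb hacb]; linarith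
        by_cases hda : e.val = b.val
        · obtain rfl : e = b := Fin.ext hda
          rw [hbc]
          exact ⟨fun _ => by linarith, fun _ => by linarith⟩
        · have hadne : e ≠ b := fun h => hda (congrArg Fin.val h)
          have := hright e b (by omega) (by omega) le_rfl ⟨hadne, P, hP, he, hb⟩
          have h3 := hβ' c hc e he b hb (by unfold CycLt; omega)
          constructor <;> intro h <;> rw [h] at h3 <;> linarith
      rw [hdce]
      rcases hβ with h | h
      · rw [h] at hs ⊢
        have := k1.1 h
        have := k2.1 h
        constructor <;> linarith
      · rw [h] at hs ⊢
        have := k1.2 h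
        have := k2.2 h
        constructor <;> linarith
    -- An arc of another polygon cannot straddle `c` inside `[a, b]` unless it is `a → b` itself.
    · rcases subset_cycIcc_or_or hQ hP (Ne.symm hPQ) ha hc hb hacb with hs | hs | hs
      · have := mem_cycIcc.1 (hs he)
        omega
      · have := mem_cycIcc.1 (hs hd)
        omega
      · have h3 := mem_cycIcc.1 (hs hd)
        have h4 := mem_cycIcc.1 (hs he)
        obtain rfl : a = d := Fin.ext (by omega)
        obtain rfl : e = b := Fin.ext (by omega)
        rw [hYa, hYb]
        constructor <;> linarith

variable (σ) in
/-- The points of the tile that satisfy all its inequalities strictly. -/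
def strictTile : Set (Fin n → ℝ) :=
  {x | ∑ i, x i = (σ.numBlackTriangles : ℝ) + 1 ∧
    ∀ a b, σ.Compatible a b →
      (σ.area a b : ℝ) < ∑ i ∈ cycIco a b, x i ∧
      ∑ i ∈ cycIco a b, x i < (σ.area a b : ℝ) + 1}

/-- Partial sums along the arc from the first to the last label settle all increasing arcs. The last
coordinate makes the total `k + 1`, and decreasing arcs follow by complement, since opposite areas
add up to `k`. -/
theorem strictTile_nonempty (hn : 2 ≤ n) : σ.strictTile.Nonempty := by
  choose s hs using exists_sub_eq_one' hn
  set z : Fin n := ⟨0, by omega⟩ with hz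
  set l : Fin n := ⟨n - 1, by omega⟩ with hl
  have hzl : z.val < l.val := by simp only [hz, hl]; omega
  have hlz : (z - l).val = 1 := by
    rw [val_sub_eq, if_neg (by omega)]; simp only [hz, hl]; omega
  have hcomp : σ.Compatible z l := (compatible_of_sub_eq_one hlz).symm
  obtain ⟨Y, -, -, hY⟩ := exists_partialSums hcomp hzl (1 / 2) (by norm_num) (by norm_num)
  set t : ℝ := (σ.numBlackTriangles : ℝ) + 1 with ht
  set x : Fin n → ℝ := fun i => Y (s i) - Y i + if s i < i then t else 0 with hx
  have hgap : ∀ p q : Fin n, (q - p).val = 1 → x p = Y q - Y p + if q < p then t else 0 := by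
    intro p q h
    have : q = s p := by
      have : q - p = s p - p := Fin.ext (h.trans (hs p).symm)
      have hp := p.isLt
      have hq := q.isLt
      have hsp := (s p).isLt
      have h1 := hs p
      rw [val_sub_eq] at h h1
      apply Fin.ext
      split_ifs at h h1 <;> omega
    rw [this]
  have hsum : ∀ a b : Fin n, a ≠ b →
      ∑ i ∈ cycIco a b, x i = Y b - Y a + if b < a then t else 0 :=
    fun a b hab => sum_cycIco_gap hgap hab
  refine ⟨x, ?_, fun a b hab => ?_⟩
  · have hne : z ≠ l := hcomp.1
    rw [← sum_cycIco_add_swap hne, hsum _ _ hne, hsum _ _ hne.symm, if_neg (by omega),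
      if_pos (show z < l from hzl)]
    ring
  · have ha := a.isLt
    have hb := b.isLt
    have hv : a.val ≠ b.val := fun e => hab.1 (Fin.ext e)
    rw [hsum a b hab.1]
    by_cases h : b < a
    · have h1 := hY b a (Nat.zero_le _) h (by simp only [hl]; omega) hab.symm
      have h2 : (σ.area a b : ℝ) + σ.area b a = σ.numBlackTriangles := by
        exact_mod_cast area_add_swap hab
      rw [if_pos h]
      constructor <;> linarith
    · have h1 := hY a b (Nat.zero_le _) (by rw [Fin.lt_def] at h; omega)
        (by simp only [hl]; omega) hab
      rw [if_neg h]
      constructor <;> linarith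

/-- Moving from a point of the tile towards a strict point makes all inequalities strict at once. -/
theorem tile_subset_closure_strictTile (hn : 2 ≤ n) : σ.tile ⊆ closure σ.strictTile := by
  obtain ⟨z, hz1, hz2⟩ := strictTile_nonempty (σ := σ) hn
  rintro x ⟨hx1, hx2⟩
  have hsum : ∀ (ε : ℝ) (s : Finset (Fin n)), ∑ i ∈ s, (x + ε • (z - x)) i =
      (1 - ε) * ∑ i ∈ s, x i + ε * ∑ i ∈ s, z i := by
    intro ε s
    rw [Finset.mul_sum, Finset.mul_sum, ← Finset.sum_add_distrib]
    refine Finset.sum_congr rfl fun i _ => ?_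
    simp only [Pi.add_apply, Pi.smul_apply, Pi.sub_apply, smul_eq_mul]
    ring
  have hlim : Filter.Tendsto (fun ε : ℝ => x + ε • (z - x)) (nhdsWithin 0 (Set.Ioi 0))
      (nhds x) := by
    have : Continuous fun ε : ℝ => x + ε • (z - x) := by fun_prop
    have h := this.tendsto 0
    rw [zero_smul, add_zero] at h
    exact h.mono_left nhdsWithin_le_nhds
  refine mem_closure_of_tendsto hlim ?_
  filter_upwards [Ioo_mem_nhdsGT (zero_lt_one' ℝ)] with ε hε
  refine ⟨?_, fun a b hab => ?_⟩
  · rw [hsum, hx1, hz1]; ring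
  · obtain ⟨h1, h2⟩ := hx2 a b hab
    obtain ⟨h3, h4⟩ := hz2 a b hab
    rw [hsum]
    have hε' : 0 < 1 - ε := sub_pos.2 hε.2
    constructor
    · nlinarith [mul_le_mul_of_nonneg_left h1 hε'.le, mul_lt_mul_of_pos_left h3 hε.1]
    · nlinarith [mul_le_mul_of_nonneg_left h2 hε'.le, mul_lt_mul_of_pos_left h4 hε.1]

end BicoloredSubdivision

/-- A point of the hypersimplex with coordinates in `(0, 1)` lies in a `w`-simplex: `w` sorts the
fractional parts of its partial sums. -/
theorem exists_mem_wSimplex {n : ℕ} [NeZero n] (hn : 2 ≤ n) {x : Fin n → ℝ} {m : ℤ}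
    (hsum : ∑ i, x i = m) (h0 : ∀ i, 0 < x i) (h1 : ∀ i, x i < 1) :
    ∃ w ∈ DAll n, x ∈ wSimplex w := by
  have hl : n - 1 + 1 = n := by omega
  set l : Fin n := ⟨n - 1, by omega⟩ with hld
  set y : Fin n → ℝ := fun i => ∑ j ∈ cycIco l i, x j with hy
  have hyl : y l = 0 := by
    have : cycIco l l = ∅ := by
      ext i
      rw [mem_cycIco]
      simp only [Finset.notMem_empty, iff_false]
      omega
    simp only [hy, this, Finset.sum_empty]
  have hstep : ∀ i j : Fin n, (j - i).val = 1 → ∃ t : ℤ, x i = y j - y i + t := by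
    intro i j hij
    by_cases hi : i = l
    · refine ⟨0, ?_⟩
      rw [hi, hyl, hy]
      simp only
      rw [sum_cycIco_of_sub_eq_one (hi ▸ hij)]
      simp
    by_cases hj : j = l
    · refine ⟨m, ?_⟩
      rw [hj, hyl]
      have h2 := sum_cycIco_add_swap (Ne.symm hi) x
      rw [sum_cycIco_of_sub_eq_one (a := i) (hj ▸ hij), hsum] at h2
      simp only [hy]
      linarith
    · refine ⟨0, ?_⟩
      have hlt : CycLt l i j := by
        have hi' := i.isLt
        have hj' := j.isLt
        have h2 : i.val ≠ l.val := fun e => hi (Fin.ext e)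
        have h3 : j.val ≠ l.val := fun e => hj (Fin.ext e)
        rw [val_sub_eq] at hij
        simp only [hld] at h2 h3
        simp only [CycLt, hld]
        split_ifs at hij <;> omega
      have h2 := sum_cycIco_add hlt x
      rw [sum_cycIco_of_sub_eq_one hij] at h2
      simp only [hy]
      push_cast
      linarith
  -- The fractional part of `y i` taken in `(0, 1]`: the label `l`, with `y l = 0`, gets the largest
  -- value 1. Ties are broken by label, so `l` ends the word.
  set θ : Fin n → ℝ := fun i => 1 - Int.fract (-y i) with hθ
  have hθ0 : ∀ i, 0 < θ i := fun i => sub_pos.2 (Int.fract_lt_one _)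
  have hθ1 : ∀ i, θ i ≤ 1 := fun i => sub_le_self _ (Int.fract_nonneg _)
  have hθl : θ l = 1 := by simp [hθ, hyl]
  have hθy : ∀ i, θ i = y i + (1 + ⌊-y i⌋) := by
    intro i
    simp only [hθ, Int.fract]
    ring
  obtain ⟨w, hw⟩ := exists_perm_of_strict_total
    (r := fun a b : Fin n => θ a < θ b ∨ (θ a = θ b ∧ a < b))
    (by
      rintro a b c (h | ⟨h, h'⟩) (k | ⟨k, k'⟩)
      · exact Or.inl (h.trans k)
      · exact Or.inl (k ▸ h)
      · exact Or.inl (h ▸ k)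
      · exact Or.inr ⟨h.trans k, h'.trans k'⟩)
    (by
      rintro a (h | ⟨-, h⟩)
      · exact lt_irrefl _ h
      · exact lt_irrefl _ h)
    (by
      intro a b hab
      rcases lt_trichotomy (θ a) (θ b) with h | h | h
      · exact Or.inl (Or.inl h)
      · rcases lt_or_gt_of_ne hab with h' | h'
        · exact Or.inl (Or.inr ⟨h, h'⟩)
        · exact Or.inr (Or.inr ⟨h.symm, h'⟩)
      · exact Or.inr (Or.inl h))
  refine ⟨w, DAll_iff.2 fun l' i hl' hi => ?_, mem_wSimplex_of_position hn (θ := θ) ?_ ?_ ?_⟩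
  · obtain rfl : l' = l := Fin.ext (by simp only [hld]; omega)
    rw [hw, hθl]
    rcases (hθ1 i).lt_or_eq with h | h
    · exact Or.inl h
    · refine Or.inr ⟨h, ?_⟩
      have h2 : i.val ≠ l.val := fun e => hi (Fin.ext e)
      have := i.isLt
      rw [Fin.lt_def]
      simp only [hld] at *
      omega
  · intro p q hpq
    by_contra h
    have h2 := (hw (w q) (w p)).2 (Or.inl (not_le.1 h))
    simp only [Equiv.symm_apply_apply] at h2
    exact absurd hpq (not_le.2 h2)
  · intro i j
    linarith [hθ0 j, hθ1 i]
  · intro i j hij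
    obtain ⟨t, ht⟩ := hstep i j hij
    obtain ⟨t', ht'⟩ : ∃ t' : ℤ, x i = θ j - θ i + t' := by
      refine ⟨t - ⌊-y j⌋ + ⌊-y i⌋, ?_⟩
      rw [ht, hθy, hθy]
      push_cast
      ring
    have b0 := h0 i
    have b1 := h1 i
    have hi0 := hθ0 i
    have hi1 := hθ1 i
    have hj0 := hθ0 j
    have hj1 := hθ1 j
    have c1 : (-1 : ℝ) < t' := by linarith
    have c2 : (t' : ℝ) < 2 := by linarith
    have c3 : t' = 0 ∨ t' = 1 := by
      have c1 : -1 < t' := by exact_mod_cast c1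
      have c2 : t' < 2 := by exact_mod_cast c2
      omega
    -- As `0 < x i < 1`, the integer is 0 when `θ i < θ j` and 1 when `θ j < θ i`; a tie would make
    -- `x i` an integer.
    rcases c3 with rfl | rfl
    · have hlt : θ i < θ j := by push_cast at ht'; linarith
      have := (hw i j).2 (Or.inl hlt)
      rw [if_neg this.not_gt, ht']
      push_cast; rfl
    · have hlt : θ j < θ i := by push_cast at ht'; linarith
      rw [if_pos ((hw j i).2 (Or.inl hlt)), ht']
      push_cast; rfl

/-! ### Words respecting `σ`, the covering of the tile, and the order `C_σ`. -/

namespace BicoloredSubdivision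

variable {n : ℕ} {σ : BicoloredSubdivision n}

theorem mem_order {a b c : Fin n} : (a, b, c) ∈ σ.order ↔
    (∃ P ∈ σ.white, (a ∈ P ∧ b ∈ P ∧ c ∈ P) ∧ CycLt a b c) ∨
      ∃ P ∈ σ.black, (a ∈ P ∧ b ∈ P ∧ c ∈ P) ∧ CycLt c b a := by
  simp only [order, Set.mem_union, Set.mem_iUnion, mem_chain_clockwise,
    mem_chain_counterclockwise, exists_prop]

theorem respects_iff [NeZero n] {w : Equiv.Perm (Fin n)} :
    σ.Respects w ↔ σ.order ⊆ wOrder w := by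
  have hc : ∀ P : Finset (Fin n), (clockwise P).Nodup := fun P => Finset.sort_nodup P _
  have hcc : ∀ P : Finset (Fin n), (counterclockwise P).Nodup :=
    fun P => List.nodup_reverse.2 (hc P)
  simp only [Respects, order, Set.union_subset_iff, Set.iUnion_subset_iff,
    seenInOrder_iff (hc _), seenInOrder_iff (hcc _)]

theorem wOrder_mem_Ext_iff [NeZero n] {w : Equiv.Perm (Fin n)} :
    wOrder w ∈ Ext σ.order ↔ σ.Respects w := by
  rw [respects_iff]
  exact ⟨fun h => h.2, fun h => ⟨isTotalCyclicOrder_wOrder w, h⟩⟩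

/-- Winding and area obey the same recursion over triangles, with the same values on sides. -/
theorem Respects.wind_eq_area [NeZero n] {w : Equiv.Perm (Fin n)} (h : σ.Respects w)
    {a b : Fin n} (hab : σ.Compatible a b) : wind w a b = σ.area a b := by
  rw [respects_iff] at h
  refine compatible_induction (M := fun a b => wind w a b = σ.area a b) ?_ ?_ hab
  · intro a b hab
    rw [wind_of_sub_eq_one w hab, area_of_sub_eq_one hab]
  · intro P hP a ha c hc b hb hacb h1 h2
    rw [wind_add w hacb, area_add hP ha hc hb hacb, h1, h2]
    congr 1
    by_cases hB : P ∈ σ.black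
    · have := mem_wOrder.1 (h (mem_order.2 (Or.inr ⟨P, hB, ⟨hb, hc, ha⟩, hacb⟩)))
      rw [if_pos hB, if_neg]
      unfold CycLt at *
      omega
    · have hW : P ∈ σ.white := (Finset.mem_union.1 hP).resolve_right hB
      have := mem_wOrder.1 (h (mem_order.2 (Or.inl ⟨P, hW, ⟨ha, hc, hb⟩, hacb⟩)))
      rw [if_neg hB, if_pos this]

/-- Comparing the two recursions on a triangle of `P` shows that `w` reverses it iff `P` is black.
-/
theorem respects_of_wind_eq_area [NeZero n] {w : Equiv.Perm (Fin n)}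
    (h : ∀ a b, σ.Compatible a b → wind w a b = σ.area a b) : σ.Respects w := by
  have key : ∀ P ∈ σ.polygons, ∀ a ∈ P, ∀ c ∈ P, ∀ b ∈ P, CycLt a c b →
      (if CycLt (w.symm a) (w.symm c) (w.symm b) then 0 else 1) =
        if P ∈ σ.black then 1 else 0 := by
    intro P hP a ha c hc b hb hacb
    have h1 := wind_add w hacb
    rw [h a b ⟨hacb.ne.2.2, P, hP, ha, hb⟩, h a c ⟨hacb.ne.1, P, hP, ha, hc⟩,
      h c b ⟨hacb.ne.2.1, P, hP, hc, hb⟩, area_add hP ha hc hb hacb] at h1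
    omega
  rw [respects_iff]
  rintro ⟨a, b, c⟩ habc
  rcases mem_order.1 habc with ⟨P, hP, ⟨ha, hb, hc⟩, hlt⟩ | ⟨P, hP, ⟨ha, hb, hc⟩, hlt⟩
  · have hB : P ∉ σ.black := Finset.disjoint_left.1 σ.color_disjoint hP
    have h1 := key P (Finset.mem_union_left _ hP) a ha b hb c hc hlt
    rw [if_neg hB] at h1
    rw [mem_wOrder]
    by_contra hne
    rw [if_neg hne] at h1
    exact one_ne_zero h1
  · have h1 := key P (Finset.mem_union_right _ hP) c hc b hb a ha hlt
    rw [if_pos hP] at h1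
    rcases (isTotalCyclicOrder_wOrder w).total a b c hlt.ne.2.1.symm hlt.ne.1.symm
      hlt.ne.2.2.symm with h2 | h2
    · exact h2
    · rw [mem_wOrder] at h2
      rw [if_pos (by unfold CycLt at *; omega)] at h1
      exact absurd h1.symm one_ne_zero

theorem exists_compatible (σ : BicoloredSubdivision n) (hn : 2 ≤ n) :
    ∃ a b, σ.Compatible a b := by
  obtain ⟨b, hb⟩ := exists_sub_eq_one' hn ⟨0, by omega⟩
  exact ⟨_, b, compatible_of_sub_eq_one hb⟩

theorem Respects.card_cDes [NeZero n] (hn : 2 ≤ n) {w : Equiv.Perm (Fin n)}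
    (h : σ.Respects w) : (cDes w).card = σ.numBlackTriangles + 1 := by
  obtain ⟨a, b, hab⟩ := σ.exists_compatible hn
  rw [Hypersimplex.card_cDes w hab.1, h.wind_eq_area hab, h.wind_eq_area hab.symm,
    area_add_swap hab]

theorem Respects.wSimplex_subset_tile [NeZero n] (hn : 2 ≤ n) {w : Equiv.Perm (Fin n)}
    (h : σ.Respects w) : wSimplex w ⊆ σ.tile := by
  intro x hx
  refine ⟨?_, fun a b hab => ?_⟩
  · obtain ⟨a, b, hab⟩ := σ.exists_compatible hn
    rw [sum_of_mem_wSimplex hx hab.1, h.wind_eq_area hab, h.wind_eq_area hab.symm,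
      ← area_add_swap hab]
    push_cast; rfl
  · rw [← h.wind_eq_area hab]
    exact wind_le_of_mem_wSimplex hx hab.1

/-- The extreme values `wind` and `wind + 1` on the simplex must fit into an interval of length 1
starting at the area. -/
theorem respects_of_wSimplex_subset_tile [NeZero n] {w : Equiv.Perm (Fin n)}
    (h : wSimplex w ⊆ σ.tile) : σ.Respects w := by
  refine respects_of_wind_eq_area fun a b hab => ?_
  obtain ⟨x, hx, hxe⟩ := exists_mem_wSimplex_min w a b
  obtain ⟨y, hy, hye⟩ := exists_mem_wSimplex_max w hab.1
  have h1 := ((h hx).2 a b hab).1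
  have h2 := ((h hy).2 a b hab).2
  rw [hxe] at h1
  rw [hye] at h2
  have h1 : σ.area a b ≤ wind w a b := by exact_mod_cast h1
  have h2 : wind w a b + 1 ≤ σ.area a b + 1 := by exact_mod_cast h2
  omega

theorem wSimplex_subset_tile_iff [NeZero n] (hn : 2 ≤ n) {w : Equiv.Perm (Fin n)} :
    wSimplex w ⊆ σ.tile ↔ σ.Respects w :=
  ⟨respects_of_wSimplex_subset_tile, fun h => h.wSimplex_subset_tile hn⟩

/-- An open unit interval and a closed one, both starting at integers, share a point only if they
start at the same integer. -/
theorem exists_respects_of_mem_strictTile [NeZero n] (hn : 2 ≤ n) {x : Fin n → ℝ}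
    (hx : x ∈ σ.strictTile) : ∃ w ∈ DAll n, σ.Respects w ∧ x ∈ wSimplex w := by
  have h01 : ∀ i, 0 < x i ∧ x i < 1 := by
    intro i
    obtain ⟨j, hj⟩ := exists_sub_eq_one' hn i
    have := hx.2 i j (compatible_of_sub_eq_one hj)
    rw [sum_cycIco_of_sub_eq_one hj, area_of_sub_eq_one hj] at this
    simpa using this
  obtain ⟨w, hw, hxw⟩ := exists_mem_wSimplex hn (m := (σ.numBlackTriangles : ℤ) + 1)
    (by rw [hx.1]; push_cast; rfl) (fun i => (h01 i).1) fun i => (h01 i).2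
  refine ⟨w, hw, respects_of_wind_eq_area fun a b hab => ?_, hxw⟩
  obtain ⟨h1, h2⟩ := hx.2 a b hab
  obtain ⟨h3, h4⟩ := wind_le_of_mem_wSimplex hxw hab.1
  have h5 : wind w a b < σ.area a b + 1 := by exact_mod_cast h3.trans_lt h2
  have h6 : σ.area a b < wind w a b + 1 := by exact_mod_cast h1.trans_le h4
  omega

theorem tile_eq_iUnion [NeZero n] (hn : 2 ≤ n) :
    σ.tile = ⋃ w ∈ {w | w ∈ DAll n ∧ σ.Respects w}, wSimplex w := by
  refine Set.Subset.antisymm ?_ (Set.iUnion₂_subset fun w hw => hw.2.wSimplex_subset_tile hn)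
  have hclosed : IsClosed (⋃ w ∈ {w | w ∈ DAll n ∧ σ.Respects w}, wSimplex w) :=
    Set.Finite.isClosed_biUnion (Set.toFinite _) fun w _ =>
      (Set.finite_range _).isClosed_convexHull ℝ
  refine (tile_subset_closure_strictTile hn).trans (closure_minimal ?_ hclosed)
  intro x hx
  obtain ⟨w, hw, hr, hxw⟩ := exists_respects_of_mem_strictTile hn hx
  exact Set.mem_biUnion (show w ∈ {w | w ∈ DAll n ∧ σ.Respects w} from ⟨hw, hr⟩) hxw

/-- An edge of two polygons determines the sides on which they lie. -/
theorem eq_of_mem_of_cycLt {P Q : Finset (Fin n)} (hP : P ∈ σ.polygons) (hQ : Q ∈ σ.polygons)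
    {a b c d : Fin n} (ha : a ∈ P) (hb : b ∈ P) (hc : c ∈ P) (ha' : a ∈ Q) (hc' : c ∈ Q)
    (hd : d ∈ Q) (h1 : CycLt a b c) (h2 : CycLt a d c) : P = Q := by
  by_contra hne
  obtain ⟨i, j, hij, hs, ht⟩ := exists_chord hP hQ hne
  have ha := mem_cycIcc.1 (hs ha)
  have hb := mem_cycIcc.1 (hs hb)
  have hc := mem_cycIcc.1 (hs hc)
  have ha' := mem_cycIcc.1 (ht ha')
  have hc' := mem_cycIcc.1 (ht hc')
  have hd := mem_cycIcc.1 (ht hd)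
  have h3 : a.val = i.val ∨ a.val = j.val := by omega
  have h4 : c.val = i.val ∨ c.val = j.val := by omega
  unfold CycLt at h1 h2
  omega

theorem isCyclicOrder_order [NeZero n] (hn : 2 ≤ n) : IsCyclicOrder σ.order where
  cyclicity a b c h := by
    rw [mem_order] at *
    refine h.imp ?_ ?_
    · rintro ⟨P, hP, ⟨ha, hb, hc⟩, hlt⟩
      exact ⟨P, hP, ⟨hc, ha, hb⟩, hlt.rotate⟩
    · rintro ⟨P, hP, ⟨ha, hb, hc⟩, hlt⟩
      exact ⟨P, hP, ⟨hc, ha, hb⟩, hlt.rotate.rotate⟩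
  asymmetry a b c h h' := by
    -- Asymmetry is inherited from the cyclic order of any word respecting `σ`, and a strict point
    -- provides one.
    obtain ⟨x, hx⟩ := strictTile_nonempty (σ := σ) hn
    obtain ⟨w, -, hr, -⟩ := exists_respects_of_mem_strictTile hn hx
    rw [respects_iff] at hr
    exact (isTotalCyclicOrder_wOrder w).asymmetry _ _ _ (hr h) (hr h')
  transitivity a b c d h h' := by
    have hac : ∀ {P Q : Finset (Fin n)}, a ∈ P → c ∈ P → a ∈ Q → c ∈ Q → a ∈ P ∩ Q ∧ c ∈ P ∩ Q :=
      fun h1 h2 h3 h4 => ⟨Finset.mem_inter.2 ⟨h1, h3⟩, Finset.mem_inter.2 ⟨h2, h4⟩⟩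
    rw [mem_order] at h h' ⊢
    rcases h with ⟨P, hP, ⟨ha, hb, hc⟩, hlt⟩ | ⟨P, hP, ⟨ha, hb, hc⟩, hlt⟩ <;>
    rcases h' with ⟨Q, hQ, ⟨ha', hc', hd'⟩, hlt'⟩ | ⟨Q, hQ, ⟨ha', hc', hd'⟩, hlt'⟩
    · have hPQ : P = Q := by
        by_contra hne
        obtain ⟨h1, h2⟩ := hac ha hc ha' hc'
        exact hlt.ne.2.2 (σ.white_no_common_edge P hP Q hQ hne a h1 c h2)
      subst hPQ
      exact Or.inl ⟨P, hP, ⟨ha, hb, hd'⟩, by unfold CycLt at *; omega⟩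
    -- Opposite colors put `b` and `d` on the same side of the common chord `a c`, which forces the
    -- two polygons to coincide.
    · exfalso
      have hPQ := eq_of_mem_of_cycLt (Finset.mem_union_left _ hP) (Finset.mem_union_right _ hQ)
        ha hb hc ha' hc' hd' hlt hlt'.rotate
      exact Finset.disjoint_left.1 σ.color_disjoint hP (hPQ ▸ hQ)
    · exfalso
      have hPQ := eq_of_mem_of_cycLt (Finset.mem_union_right _ hP) (Finset.mem_union_left _ hQ)
        hc hb ha hc' ha' hd' hlt hlt'.rotate.rotate
      exact Finset.disjoint_left.1 σ.color_disjoint (hPQ ▸ hQ) hP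
    · have hPQ : P = Q := by
        by_contra hne
        obtain ⟨h1, h2⟩ := hac ha hc ha' hc'
        exact hlt.ne.2.2 (σ.black_no_common_edge P hP Q hQ hne c h2 a h1)
      subst hPQ
      exact Or.inr ⟨P, hP, ⟨ha, hb, hd'⟩, by unfold CycLt at *; omega⟩

end BicoloredSubdivision

end Hypersimplex

theorem mainTheorem4 (n k : ℕ) [NeZero n] (hn : 3 ≤ n)
    (σ : Hypersimplex.BicoloredSubdivision n) (hσ : σ.HasType k) :
    σ.tile = (⋃ w ∈ {w | w ∈ Hypersimplex.D (k + 1) n ∧ σ.Respects w},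
      Hypersimplex.wSimplex w) ∧
    (∀ w ∈ Hypersimplex.D (k + 1) n, Hypersimplex.wSimplex w ⊆ σ.tile ↔ σ.Respects w) ∧
    Hypersimplex.IsCyclicOrder σ.order ∧
    σ.tile = (⋃ w ∈ {w | w ∈ Hypersimplex.DAll n ∧
      Hypersimplex.wOrder w ∈ Hypersimplex.Ext σ.order}, Hypersimplex.wSimplex w) ∧
    Set.BijOn Hypersimplex.wOrder
      {w | w ∈ Hypersimplex.D (k + 1) n ∧ Hypersimplex.wSimplex w ⊆ σ.tile}
      (Hypersimplex.Ext σ.order) ∧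
    Set.InjOn Hypersimplex.wSimplex
      {w | w ∈ Hypersimplex.D (k + 1) n ∧ Hypersimplex.wSimplex w ⊆ σ.tile} := by
  have hn2 : 2 ≤ n := by omega
  -- Respecting `σ` already forces `k + 1` cyclic descents, so `D_n` and `D_{k+1,n}` index the same
  -- simplices.
  have hD : ∀ w, (w ∈ Hypersimplex.D (k + 1) n ∧ σ.Respects w) ↔
      (w ∈ Hypersimplex.DAll n ∧ σ.Respects w) := fun w =>
    ⟨fun h => ⟨h.1.1, h.2⟩, fun h => ⟨⟨h.1, (h.2.card_cDes hn2).trans (by rw [hσ])⟩, h.2⟩⟩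
  have hinj : {w | w ∈ Hypersimplex.D (k + 1) n ∧ Hypersimplex.wSimplex w ⊆ σ.tile} ⊆
      Hypersimplex.DAll n := fun w hw => hw.1.1
  refine ⟨?_, fun w _ => Hypersimplex.BicoloredSubdivision.wSimplex_subset_tile_iff hn2,
    Hypersimplex.BicoloredSubdivision.isCyclicOrder_order hn2, ?_, ⟨?_, ?_, ?_⟩, ?_⟩
  · simp only [hD]
    exact Hypersimplex.BicoloredSubdivision.tile_eq_iUnion hn2
  · simp only [Hypersimplex.BicoloredSubdivision.wOrder_mem_Ext_iff]
    exact Hypersimplex.BicoloredSubdivision.tile_eq_iUnion hn2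
  · intro w hw
    exact Hypersimplex.BicoloredSubdivision.wOrder_mem_Ext_iff.2
      (Hypersimplex.BicoloredSubdivision.respects_of_wSimplex_subset_tile hw.2)
  · exact (Hypersimplex.injOn_wOrder hn2).mono hinj
  · intro C hC
    obtain ⟨w, hw, rfl⟩ := Hypersimplex.exists_wOrder_eq hn2 hC.1
    have hr := Hypersimplex.BicoloredSubdivision.wOrder_mem_Ext_iff.1 hC
    exact ⟨w, ⟨((hD w).2 ⟨hw, hr⟩).1, hr.wSimplex_subset_tile hn2⟩, rfl⟩
  · exact (Hypersimplex.injOn_wSimplex hn2).mono hinj
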